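/- Fix $d$ and a norm $N$ on $\mathbb R^d$. Let $L>0$, $0\le B<1$, and let $\pi:[0,1]^d\to(0,1]$ satisfy $|\pi(x)-\pi(y)|\le L\,N(x-y)$ for all $x,y\in[0,1]^d$. Let $\mathcal S=\{(x_i,s_i)\}_{i=1,\dots,t}$ consist of $t$ independent experiments, where $x_i$ is uniform on $[0,1]^d$ and, given $x_i$, $s_i\sim\mathrm{Bernoulli}((1-B)\pi(x_i)+B)$. Inference algorithm. Given a query point $x\in[0,1]^d$, a prior $\mathrm{Beta}(\alpha,\beta)$ with $\alpha,\beta>0$, and a constant $\kappa>0$: set the kernel width $\Delta=\kappa L^{-2/(d+2)}((1-B)t)^{-1/(d+2)}$; let $n$ be the number of experiments with $\|x-x_i\|_\infty\le\Delta$ and $s$ the number of successes ($s_i=1$) among these $n$ experiments; output the posterior $$\tilde\pi(x|\mathcal S)\sim\sum_{i=0}^{s}C_i\,\mathrm{Beta}(\alpha+i,\beta+n-i),\qquad C_i\propto\binom{s}{i}\Gamma(\alpha+i)\,\Gamma(\beta+n-i)\,B^{s-i},\qquad \sum_{i=0}^{s}C_i=1,$$ that is, the numbers $s$ and $C_i,\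 \alpha+i,\ \beta+n-i$ for $0\le i\le s$. (1) For the uniform prior $\alpha=\beta=1$ and every $\kappa>0$ there is a constant $C$ depending only on $d$, $N$ and $\kappa$ such that, for all $L$, $B$, $\pi$ as above and all $t$ with $L^2(1-B)t\ge1$, $$\sup_{x\in[0,1]^d}\mathbb E_{\mathcal S}\,\mathbb E\big[(\tilde\pi(x|\mathcal S)-\pi(x))^2\big]\le C\,L^{\frac{2d}{d+2}}\big((1-B)t\big)^{-\frac{2}{d+2}}.$$ In particular, for fixed $L$ and $B$ the left-hand side is $\mathcal O\big(L^{2d/(d+2)}((1-B)t)^{-2/(d+2)}\big)$ as $t\to\infty$. (2) There is a constant $K$ depending only on $d$ such that, for every $t\ge1$, all data $(x_i,s_i)_{i\le t}$, every query point $x$ and all $\kappa,L>0$, $0\le B<1$, $\alpha,\beta>0$, the algorithm, run as a program on a real random access machine (unit cost for memory accesses, arithmetic operations, root extraction, comparisons, assignments and loop steps), computes exactly this posterior in at most $K\,t$ steps. -/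

import Mathlib

open MeasureTheory ProbabilityTheory

namespace SmoothBeta

/-! ## The statistical model -/

/-- The feature space `[0,1]^d`. Its `volume` is the uniform probability measure. -/
abbrev Cube (d : ℕ) : Type := Fin d → unitInterval

/-- The vector in `ℝ^d` underlying a point of the cube. -/
def Cube.vec {d : ℕ} (x : Cube d) : Fin d → ℝ := fun j => (x j : ℝ)

/-- The outcomes of `t` experiments: the test points and, for each of them, whether the
Bernoulli test succeeded. -/
abbrev Data (d t : ℕ) : Type := Fin t → Cube d × Bool

/-- The success probability `(1 - B) π(x) + B` of a test performed at `x` in the context `B`. -/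
def successProb {d : ℕ} (π : Cube d → ℝ) (B : ℝ) (x : Cube d) : ℝ := (1 - B) * π x + B

/-- The joint law of one experiment `(x, s)`: the point `x` is uniform on the cube and, given `x`,
the outcome `s` is Bernoulli with parameter `(1 - B) π(x) + B`. It is written through its density
with respect to the product of the uniform law and the counting measure on `{true, false}`. -/
noncomputable def experimentLaw {d : ℕ} (π : Cube d → ℝ) (B : ℝ) : Measure (Cube d × Bool) :=
  ((volume : Measure (Cube d)).prod Measure.count).withDensity fun z =>
    ENNReal.ofReal (if z.2 = true then successProb π B z.1 else 1 - successProb π B z.1)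

/-- The law of `t` independent experiments. -/
noncomputable def dataLaw {d : ℕ} (π : Cube d → ℝ) (B : ℝ) (t : ℕ) : Measure (Data d t) :=
  Measure.pi fun _ => experimentLaw π B

/-! ## The posterior -/

open Classical in
/-- The indices of the experiments in the box of half-width `Δ` around `x`. -/
noncomputable def neighbors {d t : ℕ} (Δ : ℝ) (S : Data d t) (x : Cube d) : Finset (Fin t) :=
  Finset.univ.filter fun i => ∀ j, |x.vec j - (S i).1.vec j| ≤ Δ

/-- The number of experiments in the box around `x`. -/
noncomputable def numNear {d t : ℕ} (Δ : ℝ) (S : Data d t) (x : Cube d) : ℕ :=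
  (neighbors Δ S x).card

/-- The number of successes among the experiments in the box around `x`. -/
noncomputable def numSucc {d t : ℕ} (Δ : ℝ) (S : Data d t) (x : Cube d) : ℕ :=
  ((neighbors Δ S x).filter fun i => (S i).2 = true).card

/-- The unnormalised weight `(s choose i) (α-1+i)! (β+n-1-i)! B^(s-i)` of the component
`Beta(α+i, β+n-i)`, for `s` successes in `n` tests. -/
noncomputable def mixWeight (α β B : ℝ) (n s i : ℕ) : ℝ :=
  (s.choose i : ℝ) * Real.Gamma (α + i) * Real.Gamma (β + ((n : ℝ) - i)) * B ^ (s - i)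

/-- The normalised weights: `∑ i ∈ {0, …, s}, mixCoef α β B n s i = 1`. -/
noncomputable def mixCoef (α β B : ℝ) (n s i : ℕ) : ℝ :=
  mixWeight α β B n s i / ∑ j ∈ Finset.range (s + 1), mixWeight α β B n s j

/-- The mixture `∑ i ∈ {0, …, s}, C_i Beta(α+i, β+n-i)`. -/
noncomputable def betaMixture (α β B : ℝ) (n s : ℕ) : Measure ℝ :=
  ∑ i ∈ Finset.range (s + 1),
    ENNReal.ofReal (mixCoef α β B n s i) • betaMeasure (α + i) (β + ((n : ℝ) - i))

/-- The posterior of the success probability at `x`, from the prior `Beta(α, β)`: all the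
experiments in the box around `x` are used as if they had been performed at `x`. -/
noncomputable def posterior {d t : ℕ} (α β B Δ : ℝ) (S : Data d t) (x : Cube d) : Measure ℝ :=
  betaMixture α β B (numNear Δ S x) (numSucc Δ S x)

/-- The kernel width `Δ = κ L^(-2/(d+2)) ((1-B) t)^(-1/(d+2))`. -/
noncomputable def kernelWidth (d : ℕ) (κ L B : ℝ) (t : ℕ) : ℝ :=
  κ * L ^ (-(2 : ℝ) / ((d : ℝ) + 2)) * ((1 - B) * t) ^ (-(1 : ℝ) / ((d : ℝ) + 2))

/-- The quantity `𝔼_S 𝔼 (π̃(x | S) - π(x))²`, for the uniform prior `Beta(1, 1)`. -/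
noncomputable def meanSquareError {d : ℕ} (π : Cube d → ℝ) (B Δ : ℝ) (t : ℕ) (x : Cube d) :
    ENNReal :=
  ∫⁻ S, (∫⁻ θ, ENNReal.ofReal ((θ - π x) ^ 2) ∂(posterior 1 1 B Δ S x)) ∂(dataLaw π B t)

/-- The worst case over the query point, `sup_x 𝔼_S 𝔼 (π̃(x | S) - π(x))²`. -/
noncomputable def supMeanSquareError {d : ℕ} (π : Cube d → ℝ) (B Δ : ℝ) (t : ℕ) : ENNReal :=
  ⨆ x : Cube d, meanSquareError π B Δ t x

/-! ## A real random access machine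

A structured language over a memory with integer registers (named by `V`) and arrays of real
numbers (named by `A`). Every memory access, literal, arithmetic operation, root extraction,
comparison, assignment and loop step costs one unit of time. -/

/-- The state of the memory. -/
structure Store (V A : Type) where
  /-- integer registers -/
  nat : V → ℕ
  /-- arrays of real numbers -/
  arr : A → ℕ → ℝ

/-- Integer expressions. -/
inductive NExp (V : Type) : Type
  | lit (k : ℕ)
  | var (v : V)
  | add (e f : NExp V)
  | sub (e f : NExp V)
  | mul (e f : NExp V)

/-- Real expressions; `get a i` reads the cell `i` of the array `a`. -/
inductive RExp (V A : Type) : Type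
  | lit (k : ℕ)
  | ofNat (e : NExp V)
  | get (a : A) (i : NExp V)
  | add (e f : RExp V A)
  | sub (e f : RExp V A)
  | mul (e f : RExp V A)
  | div (e f : RExp V A)
  | root (k : NExp V) (e : RExp V A)

/-- Commands; `loop v n c` runs `c` with `v = 0, …, n - 1`, where `n` is evaluated on entry. -/
inductive Cmd (V A : Type) : Type
  | skip
  | setN (v : V) (e : NExp V)
  | setR (a : A) (i : NExp V) (e : RExp V A)
  | seq (c c' : Cmd V A)
  | ifLE (e f : RExp V A) (c c' : Cmd V A)
  | loop (v : V) (n : NExp V) (c : Cmd V A)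

section Semantics

variable {V A : Type}

def NExp.eval (σ : Store V A) : NExp V → ℕ
  | .lit k => k
  | .var v => σ.nat v
  | .add e f => e.eval σ + f.eval σ
  | .sub e f => e.eval σ - f.eval σ
  | .mul e f => e.eval σ * f.eval σ

def NExp.cost : NExp V → ℕ
  | .lit _ => 1
  | .var _ => 1
  | .add e f => e.cost + f.cost + 1
  | .sub e f => e.cost + f.cost + 1
  | .mul e f => e.cost + f.cost + 1

noncomputable def RExp.eval (σ : Store V A) : RExp V A → ℝ
  | .lit k => (k : ℝ)
  | .ofNat e => (e.eval σ : ℝ)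
  | .get a i => σ.arr a (i.eval σ)
  | .add e f => e.eval σ + f.eval σ
  | .sub e f => e.eval σ - f.eval σ
  | .mul e f => e.eval σ * f.eval σ
  | .div e f => e.eval σ / f.eval σ
  | .root k e => (e.eval σ) ^ (1 / (k.eval σ : ℝ))

def RExp.cost : RExp V A → ℕ
  | .lit _ => 1
  | .ofNat e => e.cost + 1
  | .get _ i => i.cost + 1
  | .add e f => e.cost + f.cost + 1
  | .sub e f => e.cost + f.cost + 1
  | .mul e f => e.cost + f.cost + 1
  | .div e f => e.cost + f.cost + 1
  | .root k e => k.cost + e.cost + 1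

variable [DecidableEq V] [DecidableEq A]

def Store.setNat (σ : Store V A) (v : V) (k : ℕ) : Store V A :=
  { σ with nat := Function.update σ.nat v k }

def Store.setArr (σ : Store V A) (a : A) (i : ℕ) (r : ℝ) : Store V A :=
  { σ with arr := Function.update σ.arr a (Function.update (σ.arr a) i r) }

/-- `m` rounds of a timed step, numbered `0, …, m - 1`; a round costs one unit more than its
step. -/
def runLoop (step : ℕ → Store V A → Store V A × ℕ) : ℕ → Store V A → Store V A × ℕ
  | 0, σ => (σ, 0)
  | m + 1, σ =>
    let r := runLoop step m σ
    let r' := step m r.1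
    (r'.1, r.2 + r'.2 + 1)

open Classical in
/-- The effect of a command on the memory, and the time that it takes. -/
noncomputable def Cmd.run : Cmd V A → Store V A → Store V A × ℕ
  | .skip, σ => (σ, 0)
  | .setN v e, σ => (σ.setNat v (e.eval σ), e.cost + 1)
  | .setR a i e, σ => (σ.setArr a (i.eval σ) (e.eval σ), i.cost + e.cost + 1)
  | .seq c c', σ =>
    let r := c.run σ
    let r' := c'.run r.1
    (r'.1, r.2 + r'.2)
  | .ifLE e f c c', σ =>
    let r := if e.eval σ ≤ f.eval σ then c.run σ else c'.run σ
    (r.1, e.cost + f.cost + 1 + r.2)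
  | .loop v n c, σ =>
    let r := runLoop (fun k τ => c.run (τ.setNat v k)) (n.eval σ) σ
    (r.1, n.cost + 1 + r.2)

end Semantics

/-! ## The inference algorithm as a program -/

/-- Integer registers: the number `t` of tests, the dimension `d`, the number of neighboring
tests, the number of successes among them, and two indices. -/
inductive Reg : Type
  | tests
  | dim
  | near
  | succs
  | i
  | j
  deriving DecidableEq

/-- Real arrays. Scalars are kept in the cell `0`. -/
inductive Arr : Type
  | point
  | outcome
  | query
  | context
  | priorA
  | priorB
  | lipschitz
  | kappa
  | width
  | flag
  | weight
  | total
  | coef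
  | shapeA
  | shapeB
  deriving DecidableEq

abbrev Memory : Type := Store Reg Arr

/-- The scalar kept in the cell `0` of `a`. -/
def scalar (a : Arr) : RExp Reg Arr := .get a (.lit 0)

/-- The coordinate `j` of the test point `i`. -/
def pointCoord : RExp Reg Arr := .get .point (.add (.mul (.var .i) (.var .dim)) (.var .j))

/-- `width := κ / (L * L * (1 - B) * t)^(1/(d+2))`. -/
def setWidth : Cmd Reg Arr :=
  .setR .width (.lit 0)
    (.div (scalar .kappa)
      (.root (.add (.var .dim) (.lit 2))
        (.mul (.mul (.mul (scalar .lipschitz) (scalar .lipschitz))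
          (.sub (.lit 1) (scalar .context))) (.ofNat (.var .tests)))))

/-- `flag := 1` if the test point `i` lies in the box around the query point, else `0`. -/
def testNear : Cmd Reg Arr :=
  .seq (.setR .flag (.lit 0) (.lit 1))
    (.loop .j (.var .dim)
      (.seq
        (.ifLE (.sub (.get .query (.var .j)) pointCoord) (scalar .width)
          .skip (.setR .flag (.lit 0) (.lit 0)))
        (.ifLE (.sub pointCoord (.get .query (.var .j))) (scalar .width)
          .skip (.setR .flag (.lit 0) (.lit 0)))))

/-- Count the neighboring tests and the successes among them. -/
def countNear : Cmd Reg Arr :=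
  .seq (.setN .near (.lit 0)) <|
  .seq (.setN .succs (.lit 0)) <|
  .loop .i (.var .tests) <|
  .seq testNear <|
  .ifLE (.lit 1) (scalar .flag)
    (.seq (.setN .near (.add (.var .near) (.lit 1)))
      (.ifLE (.lit 1) (.get .outcome (.var .i))
        (.setN .succs (.add (.var .succs) (.lit 1)))
        .skip))
    .skip

/-- The weights up to a common factor, through the relation
`C_(i+1) = (s-i)(α+i) / (B(i+1)(β+n-1-i)) C_i` solved for `C_i` and run downwards from `C_s := 1`,
so that nothing is divided by `B`, which may be `0`. -/
def setWeights : Cmd Reg Arr :=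
  .seq (.setR .weight (.var .succs) (.lit 1)) <|
  .loop .j (.var .succs) <|
  .seq (.setN .i (.sub (.sub (.var .succs) (.lit 1)) (.var .j))) <|
  .setR .weight (.var .i)
    (.div
      (.mul (.get .weight (.add (.var .i) (.lit 1)))
        (.mul (.mul (scalar .context) (.ofNat (.add (.var .i) (.lit 1))))
          (.add (scalar .priorB) (.ofNat (.sub (.sub (.var .near) (.lit 1)) (.var .i))))))
      (.mul (.ofNat (.sub (.var .succs) (.var .i)))
        (.add (scalar .priorA) (.ofNat (.var .i)))))

/-- Normalise the weights and write out the parameters of the mixture. -/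
def writePosterior : Cmd Reg Arr :=
  .seq (.setR .total (.lit 0) (.lit 0)) <|
  .seq
    (.loop .i (.add (.var .succs) (.lit 1))
      (.setR .total (.lit 0) (.add (scalar .total) (.get .weight (.var .i))))) <|
  .loop .i (.add (.var .succs) (.lit 1)) <|
  .seq (.setR .coef (.var .i) (.div (.get .weight (.var .i)) (scalar .total))) <|
  .seq (.setR .shapeA (.var .i) (.add (scalar .priorA) (.ofNat (.var .i)))) <|
  .setR .shapeB (.var .i)
    (.add (scalar .priorB) (.ofNat (.sub (.var .near) (.var .i))))

/-- The inference algorithm, at one query point: set the kernel width, find the neighboring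
experiments, compute the posterior from them. -/
def inference : Cmd Reg Arr :=
  .seq setWidth (.seq countNear (.seq setWeights writePosterior))

/-- The memory holds the input of the algorithm; the cells not mentioned are arbitrary. -/
structure HoldsInput {d t : ℕ} (σ : Memory) (κ L B α β : ℝ) (S : Data d t) (x : Cube d) :
    Prop where
  tests : σ.nat .tests = t
  dim : σ.nat .dim = d
  point : ∀ (i : Fin t) (j : Fin d), σ.arr .point (i * d + j) = (S i).1.vec j
  outcome : ∀ i : Fin t, σ.arr .outcome i = if (S i).2 = true then 1 else 0
  query : ∀ j : Fin d, σ.arr .query j = x.vec j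
  context : σ.arr .context 0 = B
  priorA : σ.arr .priorA 0 = α
  priorB : σ.arr .priorB 0 = β
  lipschitz : σ.arr .lipschitz 0 = L
  kappa : σ.arr .kappa 0 = κ

/-- The memory describes the mixture `betaMixture α β B n s`: it holds `s`, and for every
`i ∈ {0, …, s}` the weight `C_i` and the two parameters of the component `i`. -/
structure HoldsMixture (σ : Memory) (α β B : ℝ) (n s : ℕ) : Prop where
  succs : σ.nat .succs = s
  coef : ∀ i ≤ s, σ.arr .coef i = mixCoef α β B n s i
  shapeA : ∀ i ≤ s, σ.arr .shapeA i = α + i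
  shapeB : ∀ i ≤ s, σ.arr .shapeB i = β + ((n : ℝ) - i)

end SmoothBeta

/-! Rate. Write c = 1 − B. For the uniform prior, expanding (cθ + B)^s = (θ + B(1 − θ))^s shows that
the mixture is the law on [0,1] with density proportional to (cθ + B)^s (1 − θ)^r, where r = n − s
counts the failures. Integration by parts bounds its second moment about any p ∈ [0,1] by (a − p)² +
2/m, where m = c(n + 2) and a = 1 − (r + 1)/m (`integral_sq_mul_likelihood_le`). So no concentration
argument about the Beta components is needed, and what remains is a statement about the estimator a.

Its error at p = π(x) splits into a bias, at most the oscillation of π on the box; a centered noise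
Z/(c(n + 2)); and a term of order 1/(c(n + 2)) from the prior. Counting failures rather than
successes is what gives the right dependence on B: a failure has probability c(1 − π) ≤ c, so the
noise of one test has variance at most c, and dividing by c² leaves only one factor 1/c. Since n is
random, the noise is handled by a self-normalised second moment (`integral_sq_sum_div_le`) and the
inverse moment E[1/(n + 1)] ≤ 1/(tq), where q is the volume of the box (`integral_inv_count_le`).
Both come from removing one sample point, which is independent of the others. The resulting bound is
3ε² + 8/(ctq) with ε of order LΔ and q of order Δ^d; the kernel width gives both terms the same
order.

Running time. Each loop of the program is treated by an invariant with a uniform bound on the time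
of a round. The scan costs O(d) per test; the weights obey a two-term recursion, so the mixture
costs O(s + 1), and s ≤ n ≤ t. -/

namespace SmoothBeta

/-! ### Second moments of the posterior for the uniform prior -/

/-- The unnormalised density of the posterior for the uniform prior, with `s` successes and
`r` failures. -/
noncomputable def likelihood (B : ℝ) (s r : ℕ) (θ : ℝ) : ℝ :=
  ((1 - B) * θ + B) ^ s * (1 - θ) ^ r

lemma continuous_likelihood (B : ℝ) (s r : ℕ) : Continuous (likelihood B s r) := by
  unfold likelihood; fun_prop

lemma likelihood_nonneg {B : ℝ} (hB : 0 ≤ B) (hB1 : B < 1) (s r : ℕ) {θ : ℝ}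
    (h0 : 0 ≤ θ) (h1 : θ ≤ 1) : 0 ≤ likelihood B s r θ := by
  have : 0 ≤ (1 - B) * θ := mul_nonneg (by linarith) h0
  exact mul_nonneg (pow_nonneg (by linarith) _) (pow_nonneg (by linarith) _)

lemma likelihood_pos {B : ℝ} (hB : 0 ≤ B) (hB1 : B < 1) (s r : ℕ) {θ : ℝ}
    (h0 : 0 < θ) (h1 : θ < 1) : 0 < likelihood B s r θ := by
  have : 0 < (1 - B) * θ := mul_pos (by linarith) h0
  exact mul_pos (pow_pos (by linarith) _) (pow_pos (by linarith) _)

lemma integral_likelihood_pos {B : ℝ} (hB : 0 ≤ B) (hB1 : B < 1) (s r : ℕ) :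
    0 < ∫ θ in (0 : ℝ)..1, likelihood B s r θ :=
  intervalIntegral.intervalIntegral_pos_of_pos_on
    ((continuous_likelihood B s r).intervalIntegrable _ _)
    (fun _ hθ => likelihood_pos hB hB1 s r hθ.1 hθ.2) one_pos

/-- Binomial expansion of (θ + B(1 − θ))^s: this is where the mixture of Beta densities comes from.
-/
lemma likelihood_eq_sum (B : ℝ) {n s : ℕ} (hsn : s ≤ n) (θ : ℝ) :
    likelihood B s (n - s) θ =
      ∑ i ∈ Finset.range (s + 1), (s.choose i : ℝ) * B ^ (s - i) * (θ ^ i * (1 - θ) ^ (n - i)) := by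
  have h : (1 - B) * θ + B = θ + B * (1 - θ) := by ring
  rw [likelihood, h, add_pow, Finset.sum_mul]
  refine Finset.sum_congr rfl fun i hi => ?_
  have hi' : i ≤ s := Nat.lt_succ_iff.1 (Finset.mem_range.1 hi)
  rw [mul_pow, show n - i = (s - i) + (n - s) by omega, pow_add]
  ring

/-- Since (1 − B)θ + B = 1 − (1 − B)(1 − θ), the logarithmic derivative has an affine numerator. The
derivative is therefore an affine function times the likelihood with both exponents lowered by one.
-/
lemma hasDerivAt_likelihood_succ (B : ℝ) (s r : ℕ) (θ : ℝ) :
    HasDerivAt (likelihood B (s + 1) (r + 1))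
      (likelihood B s r θ * ((1 - B) * ((s + r : ℕ) + 2) * (1 - θ) - (r + 1))) θ := by
  have h1 : HasDerivAt (fun θ : ℝ => (1 - B) * θ + B) (1 - B) θ := by
    simpa using ((hasDerivAt_id θ).const_mul (1 - B)).add_const B
  have h2 : HasDerivAt (fun θ : ℝ => 1 - θ) (-1) θ := (hasDerivAt_id θ).const_sub 1
  convert! (h1.pow (s + 1)).mul (h2.pow (r + 1)) using 1
  simp only [likelihood, Nat.add_sub_cancel, Pi.pow_apply]
  push_cast
  ring

/-- Integration by parts against `π - θ` controls the second moment of the posterior. -/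
lemma integral_sq_mul_likelihood_le {B : ℝ} (hB : 0 ≤ B) (hB1 : B < 1) (s r : ℕ) {p : ℝ}
    (hp : 0 ≤ p) :
    ∫ θ in (0 : ℝ)..1, (θ - p) ^ 2 * likelihood B s r θ ≤
      ((1 - ((r : ℝ) + 1) / ((1 - B) * ((s + r : ℕ) + 2)) - p) ^ 2 +
        2 / ((1 - B) * ((s + r : ℕ) + 2))) * ∫ θ in (0 : ℝ)..1, likelihood B s r θ := by
  have hcM : 0 < (1 - B) * (((s + r : ℕ) : ℝ) + 2) := mul_pos (by linarith) (by positivity)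
  set m : ℝ := (1 - B) * (((s + r : ℕ) : ℝ) + 2) with hm
  set a : ℝ := 1 - ((r : ℝ) + 1) / m with ha
  have hcg := continuous_likelihood B s r
  -- The affine factor in v' equals m(a − θ), so the left-hand side is the integral of the quadratic
  -- m(p − θ)(a − θ) against the likelihood.
  have hparts := intervalIntegral.integral_mul_deriv_eq_deriv_mul (a := (0 : ℝ)) (b := 1)
    (u := fun θ => p - θ) (u' := fun _ => -1) (v := likelihood B (s + 1) (r + 1))
    (v' := fun θ => likelihood B s r θ * (m * (1 - θ) - (r + 1)))
    (fun θ _ => (hasDerivAt_id θ).const_sub p)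
    (fun θ _ => hasDerivAt_likelihood_succ B s r θ)
    (Continuous.intervalIntegrable (by fun_prop) _ _)
    (Continuous.intervalIntegrable (by fun_prop) _ _)
  have hv1 : likelihood B (s + 1) (r + 1) 1 = 0 := by simp [likelihood]
  have hv0 : 0 ≤ likelihood B (s + 1) (r + 1) 0 := likelihood_nonneg hB hB1 _ _ le_rfl zero_le_one
  have hle : ∫ θ in (0 : ℝ)..1, likelihood B (s + 1) (r + 1) θ ≤
      ∫ θ in (0 : ℝ)..1, likelihood B s r θ := by
    refine intervalIntegral.integral_mono_on zero_le_one
      ((continuous_likelihood _ _ _).intervalIntegrable _ _) (hcg.intervalIntegrable _ _) ?_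
    intro θ hθ
    have e : likelihood B (s + 1) (r + 1) θ =
        (((1 - B) * θ + B) * (1 - θ)) * likelihood B s r θ := by
      simp only [likelihood]; ring
    rw [e]
    refine mul_le_of_le_one_left (likelihood_nonneg hB hB1 s r hθ.1 hθ.2) ?_
    have h1 : (1 - B) * θ + B ≤ 1 := by nlinarith [hθ.2]
    have h2 : 0 ≤ 1 - θ := by linarith [hθ.2]
    nlinarith [hθ.1]
  -- The boundary term at 1 vanishes and the one at 0 is −p v(0) ≤ 0. The remaining integral is that
  -- of v, which is at most that of the likelihood.
  have hup : ∫ θ in (0 : ℝ)..1, (p - θ) * (likelihood B s r θ * (m * (1 - θ) - (r + 1))) ≤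
      ∫ θ in (0 : ℝ)..1, likelihood B s r θ := by
    rw [hparts, hv1]
    simp only [neg_mul, one_mul, intervalIntegral.integral_neg, mul_zero, sub_zero]
    nlinarith [mul_nonneg hp hv0]
  -- Pointwise, (p − θ)(a − θ) ≥ ((θ − p)² − (a − p)²)/2, the gap being (a − θ)²/2.
  have hlow : ∫ θ in (0 : ℝ)..1, (m / 2 * ((θ - p) ^ 2 * likelihood B s r θ) -
        m / 2 * (a - p) ^ 2 * likelihood B s r θ) ≤
      ∫ θ in (0 : ℝ)..1, (p - θ) * (likelihood B s r θ * (m * (1 - θ) - (r + 1))) := by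
    refine intervalIntegral.integral_mono_on zero_le_one
      (Continuous.intervalIntegrable (by fun_prop) _ _)
      (Continuous.intervalIntegrable (by fun_prop) _ _) ?_
    intro θ hθ
    have hg := likelihood_nonneg hB hB1 s r hθ.1 hθ.2
    have e : m * (1 - θ) - (r + 1) = m * (a - θ) := by
      rw [ha]; field_simp; ring
    rw [e]
    have : 0 ≤ m / 2 * likelihood B s r θ * ((p - θ) + (a - θ) - (p - θ)) ^ 2 := by positivity
    nlinarith [mul_nonneg (mul_nonneg hcM.le hg) (sq_nonneg (p - θ + (a - p)))]
  rw [intervalIntegral.integral_sub (Continuous.intervalIntegrable (by fun_prop) _ _)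
      (Continuous.intervalIntegrable (by fun_prop) _ _),
    intervalIntegral.integral_const_mul, intervalIntegral.integral_const_mul] at hlow
  have h := hlow.trans hup
  set J := ∫ θ in (0 : ℝ)..1, (θ - p) ^ 2 * likelihood B s r θ
  set I := ∫ θ in (0 : ℝ)..1, likelihood B s r θ
  have : m / 2 * J ≤ m / 2 * (((a - p) ^ 2 + 2 / m) * I) := by
    have e : m / 2 * (((a - p) ^ 2 + 2 / m) * I) = m / 2 * (a - p) ^ 2 * I + I := by
      field_simp
    linarith
  exact le_of_mul_le_mul_left this (by positivity)

/-- The trivial bound, needed when (1 − B)(n + 2) is too small for the previous estimate to be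
useful. -/
lemma integral_sq_mul_likelihood_le_one {B : ℝ} (hB : 0 ≤ B) (hB1 : B < 1) (s r : ℕ) {p : ℝ}
    (hp : 0 ≤ p) (hp1 : p ≤ 1) :
    ∫ θ in (0 : ℝ)..1, (θ - p) ^ 2 * likelihood B s r θ ≤
      ∫ θ in (0 : ℝ)..1, likelihood B s r θ := by
  have hcg := continuous_likelihood B s r
  refine intervalIntegral.integral_mono_on zero_le_one
    (Continuous.intervalIntegrable (by fun_prop) _ _) (hcg.intervalIntegrable _ _) ?_
  intro θ hθ
  refine mul_le_of_le_one_left (likelihood_nonneg hB hB1 s r hθ.1 hθ.2) ?_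
  nlinarith [hθ.1, hθ.2]

/-- The integral of a nonnegative continuous function against a Beta law with integer
parameters. -/
lemma lintegral_betaMeasure_nat {f : ℝ → ℝ} (hf : Continuous f) (h0 : ∀ θ, 0 ≤ f θ) (i k : ℕ) :
    ∫⁻ θ, ENNReal.ofReal (f θ) ∂(betaMeasure (1 + i) (1 + k)) =
      ENNReal.ofReal ((1 / beta (1 + i) (1 + k)) *
        ∫ θ in (0 : ℝ)..1, f θ * (θ ^ i * (1 - θ) ^ k)) := by
  have hb : 0 < beta (1 + i) (1 + k) := beta_pos (by positivity) (by positivity)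
  have hm : Measurable (betaPDF (1 + i) (1 + k)) := (measurable_betaPDFReal _ _).ennreal_ofReal
  rw [betaMeasure, lintegral_withDensity_eq_lintegral_mul _ hm hf.measurable.ennreal_ofReal,
    ← intervalIntegral.integral_const_mul, intervalIntegral.integral_of_le zero_le_one,
    integral_Ioc_eq_integral_Ioo, ofReal_integral_eq_lintegral_ofReal,
    ← lintegral_indicator measurableSet_Ioo]
  · refine lintegral_congr fun θ => ?_
    by_cases hθ : θ ∈ Set.Ioo (0 : ℝ) 1
    · rw [Set.indicator_of_mem hθ, Pi.mul_apply, betaPDF_of_pos_lt_one hθ.1 hθ.2,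
        ← ENNReal.ofReal_mul]
      · congr 1
        simp only [add_sub_cancel_left, Real.rpow_natCast]
        ring
      · have := hθ.2
        have := hθ.1
        have h3 : 0 ≤ 1 - θ := by linarith
        positivity
    · rw [Set.indicator_of_notMem hθ, Pi.mul_apply, betaPDF_eq, if_neg (by simpa using hθ)]
      simp
  · refine Continuous.integrableOn_Icc (by fun_prop) |>.mono_set Set.Ioo_subset_Icc_self
  · refine ae_restrict_of_forall_mem measurableSet_Ioo fun θ hθ => ?_
    have := hθ.1
    have h3 : 0 ≤ 1 - θ := by linarith [hθ.2]
    have := h0 θ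
    show 0 ≤ _
    positivity

/-- Read off from the total mass 1 of the Beta law, by integrating the constant 1. -/
lemma integral_beta_nat (i k : ℕ) :
    ∫ θ in (0 : ℝ)..1, θ ^ i * (1 - θ) ^ k = beta (1 + i) (1 + k) := by
  have hb : 0 < beta (1 + i) (1 + k) := beta_pos (by positivity) (by positivity)
  have hprob := isProbabilityMeasureBeta (α := 1 + i) (β := 1 + k) (by positivity) (by positivity)
  have h := lintegral_betaMeasure_nat (f := fun _ => 1) continuous_const (fun _ => zero_le_one) i k
  simp only [ENNReal.ofReal_one, lintegral_one, measure_univ, one_mul] at h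
  have h1 := (ENNReal.ofReal_eq_one.1 h.symm)
  field_simp at h1
  linarith

/-- The mixture for the uniform prior is the law with density proportional to the likelihood. -/
lemma lintegral_betaMixture_one_one {B : ℝ} (hB : 0 ≤ B) {n s : ℕ} (hsn : s ≤ n)
    {f : ℝ → ℝ} (hf : Continuous f) (h0 : ∀ θ, 0 ≤ f θ) :
    ∫⁻ θ, ENNReal.ofReal (f θ) ∂(betaMixture 1 1 B n s) =
      ENNReal.ofReal ((∫ θ in (0 : ℝ)..1, f θ * likelihood B s (n - s) θ) /
        ∫ θ in (0 : ℝ)..1, likelihood B s (n - s) θ) := by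
  have hG : 0 < Real.Gamma ((n : ℝ) + 2) := Real.Gamma_pos_of_pos (by positivity)
  -- The two shape parameters always add up to n + 2, so Γ(n + 2) is a factor common to all weights
  -- and disappears on normalising.
  have hw : ∀ i ∈ Finset.range (s + 1), mixWeight 1 1 B n s i =
      Real.Gamma ((n : ℝ) + 2) *
        ((s.choose i : ℝ) * B ^ (s - i) * beta (1 + i) (1 + (n - i : ℕ))) := by
    intro i hi
    have hi' : i ≤ n := (Nat.lt_succ_iff.1 (Finset.mem_range.1 hi)).trans hsn
    rw [mixWeight, beta, Nat.cast_sub hi',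
      show (1 : ℝ) + i + (1 + ((n : ℝ) - i)) = (n : ℝ) + 2 by ring]
    field_simp
  have hI : ∫ θ in (0 : ℝ)..1, likelihood B s (n - s) θ =
      ∑ i ∈ Finset.range (s + 1),
        (s.choose i : ℝ) * B ^ (s - i) * beta (1 + i) (1 + (n - i : ℕ)) := by
    simp_rw [likelihood_eq_sum B hsn]
    rw [intervalIntegral.integral_finsetSum
      fun i _ => Continuous.intervalIntegrable (by fun_prop) _ _]
    refine Finset.sum_congr rfl fun i _ => ?_
    rw [intervalIntegral.integral_const_mul, integral_beta_nat]
  have hJ : ∫ θ in (0 : ℝ)..1, f θ * likelihood B s (n - s) θ =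
      ∑ i ∈ Finset.range (s + 1), (s.choose i : ℝ) * B ^ (s - i) *
        ∫ θ in (0 : ℝ)..1, f θ * (θ ^ i * (1 - θ) ^ (n - i)) := by
    simp_rw [likelihood_eq_sum B hsn, Finset.mul_sum]
    rw [intervalIntegral.integral_finsetSum
      fun i _ => Continuous.intervalIntegrable (by fun_prop) _ _]
    refine Finset.sum_congr rfl fun i _ => ?_
    rw [← intervalIntegral.integral_const_mul]
    refine intervalIntegral.integral_congr fun θ _ => ?_
    ring
  have hterm : ∀ i k : ℕ, 0 ≤ ∫ θ in (0 : ℝ)..1, f θ * (θ ^ i * (1 - θ) ^ k) := by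
    intro i k
    refine intervalIntegral.integral_nonneg zero_le_one fun θ hθ => ?_
    have := hθ.1
    have h3 : 0 ≤ 1 - θ := by linarith [hθ.2]
    have := h0 θ
    positivity
  -- Each weight contains the Beta normalisation of its own component, which will cancel the one in
  -- the density of that component.
  have hcoef : ∀ i ∈ Finset.range (s + 1), mixCoef 1 1 B n s i =
      (s.choose i : ℝ) * B ^ (s - i) * beta (1 + i) (1 + (n - i : ℕ)) /
        ∫ θ in (0 : ℝ)..1, likelihood B s (n - s) θ := by
    intro i hi
    rw [mixCoef, hw i hi, Finset.sum_congr rfl hw, ← Finset.mul_sum, ← hI,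
      mul_div_mul_left _ _ hG.ne']
  have hI0 : 0 ≤ ∫ θ in (0 : ℝ)..1, likelihood B s (n - s) θ := by
    rw [hI]
    refine Finset.sum_nonneg fun i _ => ?_
    have : 0 < beta (1 + i) (1 + (n - i : ℕ)) := beta_pos (by positivity) (by positivity)
    positivity
  rw [betaMixture, lintegral_finsetSum_measure, hJ, Finset.sum_div,
    ENNReal.ofReal_sum_of_nonneg]
  · refine Finset.sum_congr rfl fun i hi => ?_
    have hi' : i ≤ n := (Nat.lt_succ_iff.1 (Finset.mem_range.1 hi)).trans hsn
    have hb : 0 < beta (1 + i) (1 + (n - i : ℕ)) := beta_pos (by positivity) (by positivity)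
    rw [lintegral_smul_measure, ← Nat.cast_sub hi', lintegral_betaMeasure_nat hf h0,
      smul_eq_mul, hcoef i hi, ← ENNReal.ofReal_mul (by positivity)]
    congr 1
    field_simp
  · intro i _
    have := hterm i (n - i)
    positivity

/-- The mean square error of the posterior for the uniform prior. -/
lemma lintegral_sq_betaMixture_le {B : ℝ} (hB : 0 ≤ B) (hB1 : B < 1) (s r : ℕ) {p : ℝ}
    (hp : 0 ≤ p) (hp1 : p ≤ 1) :
    ∫⁻ θ, ENNReal.ofReal ((θ - p) ^ 2) ∂(betaMixture 1 1 B (s + r) s) ≤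
      ENNReal.ofReal (min 1 ((1 - ((r : ℝ) + 1) / ((1 - B) * ((s + r : ℕ) + 2)) - p) ^ 2 +
        2 / ((1 - B) * ((s + r : ℕ) + 2)))) := by
  have hI := integral_likelihood_pos hB hB1 s r
  rw [lintegral_betaMixture_one_one hB (Nat.le_add_right s r) (f := fun θ => (θ - p) ^ 2)
    (by fun_prop) fun θ => sq_nonneg _, Nat.add_sub_cancel_left]
  refine ENNReal.ofReal_le_ofReal (le_min ?_ ?_)
  · rw [div_le_one hI]
    exact integral_sq_mul_likelihood_le_one hB hB1 s r hp hp1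
  · rw [div_le_iff₀ hI]
    exact integral_sq_mul_likelihood_le hB hB1 s r hp

/-! ### Leave-one-out moment bounds for an independent sample -/

section IndependentSample

variable {α : Type*} {t : ℕ}

/-- The sum of `a` over the sample points other than the point `i`. -/
noncomputable def sumOthers (a : α → ℝ) (i : Fin t) (S : Fin t → α) : ℝ :=
  ∑ k ∈ Finset.univ.erase i, a (S k)

lemma sumOthers_update (a : α → ℝ) (i : Fin t) (S : Fin t → α) (z : α) :
    sumOthers a i (Function.update S i z) = sumOthers a i S := by
  refine Finset.sum_congr rfl fun k hk => ?_
  rw [Function.update_of_ne (Finset.ne_of_mem_erase hk)]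

lemma add_sumOthers (a : α → ℝ) (i : Fin t) (S : Fin t → α) :
    a (S i) + sumOthers a i S = ∑ k, a (S k) :=
  Finset.add_sum_erase _ (fun k => a (S k)) (Finset.mem_univ i)

lemma sumOthers_nonneg {a : α → ℝ} (h0 : ∀ z, 0 ≤ a z) (i : Fin t) (S : Fin t → α) :
    0 ≤ sumOthers a i S := Finset.sum_nonneg fun _ _ => h0 _

variable [MeasurableSpace α] {μ : Measure α} [IsProbabilityMeasure μ]

/-- In an independent sample, the coordinate `i` is independent of every function of the other
coordinates. -/
lemma integral_pi_mul_of_update_eq (i : Fin t) (g : α → ℝ) (H : (Fin t → α) → ℝ)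
    (hH : ∀ S z, H (Function.update S i z) = H S) :
    ∫ S, g (S i) * H S ∂(Measure.pi fun _ : Fin t => μ) =
      (∫ z, g z ∂μ) * ∫ S, H S ∂(Measure.pi fun _ : Fin t => μ) := by
  obtain ⟨t, rfl⟩ : ∃ k, t = k + 1 := ⟨t - 1, by have := i.isLt; omega⟩
  obtain ⟨z₀⟩ : Nonempty α := by
    by_contra h
    rw [not_nonempty_iff] at h
    exact IsProbabilityMeasure.ne_zero μ (Measure.eq_zero_of_isEmpty μ)
  have hconst : ∀ z r, H (i.insertNth z r) = H (i.insertNth z₀ r) := by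
    intro z r
    rw [← hH (i.insertNth z₀ r) z, Fin.update_insertNth]
  have hmp := (measurePreserving_piFinSuccAbove (fun _ : Fin (t + 1) => μ) i).symm
  -- Proved for every g with the same second factor; the choice g = 1 then identifies that factor as
  -- the integral of H.
  have key : ∀ g : α → ℝ, ∫ S, g (S i) * H S ∂(Measure.pi fun _ : Fin (t + 1) => μ) =
      (∫ z, g z ∂μ) * ∫ r, H (i.insertNth z₀ r) ∂(Measure.pi fun _ : Fin t => μ) := by
    intro g
    rw [← hmp.integral_comp', ← integral_prod_mul]
    refine integral_congr_ae (Filter.Eventually.of_forall fun z => ?_)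
    show g ((i.insertNth z.1 z.2 : Fin (t + 1) → α) i) * H (i.insertNth z.1 z.2) = _
    rw [Fin.insertNth_apply_same, hconst]
  have h1 := key fun _ => 1
  simp only [one_mul, integral_const, probReal_univ, smul_eq_mul] at h1
  rw [key g, h1]

lemma measurable_sumOthers {a : α → ℝ} (ha : Measurable a) (i : Fin t) :
    Measurable (sumOthers a i : (Fin t → α) → ℝ) :=
  Finset.measurable_sum _ fun k _ => ha.comp (measurable_pi_apply k)

lemma measurable_sum_sample {a : α → ℝ} (ha : Measurable a) :
    Measurable (fun S : Fin t → α => ∑ k, a (S k)) :=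
  Finset.measurable_sum _ fun k _ => ha.comp (measurable_pi_apply k)

variable {a : α → ℝ} (ha : Measurable a) (h01 : ∀ z, a z = 0 ∨ a z = 1)
include ha h01

/-- The inverse moment of a binomial variable. -/
lemma integral_inv_count_le :
    t * (∫ z, a z ∂μ) * ∫ S, 1 / ((∑ k, a (S k)) + 1) ∂(Measure.pi fun _ : Fin t => μ) ≤ 1 := by
  have h0 : ∀ z, 0 ≤ a z := fun z => by rcases h01 z with h | h <;> simp [h]
  have hq : 0 ≤ ∫ z, a z ∂μ := integral_nonneg h0
  have hn : ∀ S : Fin t → α, 0 ≤ ∑ k, a (S k) := fun S => Finset.sum_nonneg fun _ _ => h0 _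
  have hint : ∀ i : Fin t, Integrable (fun S => 1 / (sumOthers a i S + 1))
      (Measure.pi fun _ : Fin t => μ) := by
    intro i
    refine Integrable.of_bound (C := 1)
      ((measurable_const.div ((measurable_sumOthers ha i).add_const 1)).aestronglyMeasurable)
      (Filter.Eventually.of_forall fun S => ?_)
    have := sumOthers_nonneg h0 i S
    rw [Real.norm_of_nonneg (by positivity), div_le_one (by linarith)]
    linarith
  have hint' : ∀ i : Fin t, Integrable (fun S => a (S i) * (1 / (sumOthers a i S + 1)))
      (Measure.pi fun _ : Fin t => μ) := by
    intro i
    refine (hint i).bdd_mul (c := 1) (ha.comp (measurable_pi_apply i)).aestronglyMeasurable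
      (Filter.Eventually.of_forall fun S => ?_)
    show ‖a (S i)‖ ≤ 1
    rcases h01 (S i) with h | h <;> simp [h]
  -- Dropping the point i can only decrease the count, hence increase the inverse; after that the
  -- factor a(S i) is independent and integrates to the probability of a hit.
  have hi : ∀ i : Fin t,
      (∫ z, a z ∂μ) * ∫ S, 1 / ((∑ k, a (S k)) + 1) ∂(Measure.pi fun _ : Fin t => μ) ≤
      ∫ S, a (S i) * (1 / (sumOthers a i S + 1)) ∂(Measure.pi fun _ : Fin t => μ) := by
    intro i
    rw [integral_pi_mul_of_update_eq i a (fun S => 1 / (sumOthers a i S + 1))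
      (fun S z => by rw [sumOthers_update])]
    refine mul_le_mul_of_nonneg_left (integral_mono_of_nonneg
      (Filter.Eventually.of_forall fun S => ?_) (hint i)
      (Filter.Eventually.of_forall fun S => ?_)) hq
    · have := hn S
      show 0 ≤ 1 / ((∑ k, a (S k)) + 1)
      positivity
    · have := sumOthers_nonneg h0 i S
      have h2 := add_sumOthers a i S
      have := h0 (S i)
      exact one_div_le_one_div_of_le (by linarith) (by linarith)
  calc t * (∫ z, a z ∂μ) * ∫ S, 1 / ((∑ k, a (S k)) + 1) ∂(Measure.pi fun _ : Fin t => μ)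
      = ∑ _i : Fin t, (∫ z, a z ∂μ) *
          ∫ S, 1 / ((∑ k, a (S k)) + 1) ∂(Measure.pi fun _ : Fin t => μ) := by
        simp [mul_assoc]
    _ ≤ ∑ i : Fin t, ∫ S, a (S i) * (1 / (sumOthers a i S + 1)) ∂(Measure.pi fun _ => μ) :=
        Finset.sum_le_sum fun i _ => hi i
    _ = ∫ S, ∑ i : Fin t, a (S i) * (1 / (sumOthers a i S + 1)) ∂(Measure.pi fun _ => μ) :=
        (integral_finsetSum _ fun i _ => hint' i).symm
    _ ≤ ∫ _S, 1 ∂(Measure.pi fun _ : Fin t => μ) := by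
        refine integral_mono (integrable_finsetSum _ fun i _ => hint' i) (integrable_const _)
          fun S => ?_
        -- When the point i is counted, the + 1 puts it back and the denominator is the full count.
        -- The sum is then count/count, which is 1, or 0 if the count is 0.
        have e : ∀ i : Fin t, a (S i) * (1 / (sumOthers a i S + 1)) =
            a (S i) * (1 / ∑ k, a (S k)) := by
          intro i
          rcases h01 (S i) with h | h
          · simp [h]
          · rw [← add_sumOthers a i S, h, add_comm]
        simp_rw [e]
        rw [← Finset.sum_mul, mul_one_div]
        exact div_self_le_one _
    _ = 1 := by simp

/-- The self-normalised second moment of a sum of independent centered variables that are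
supported where `a = 1`. -/
lemma integral_sq_sum_div_le {η : α → ℝ} (hη : Measurable η) (hη1 : ∀ z, |η z| ≤ 1)
    (hηa : ∀ z, a z = 0 → η z = 0) (hmean : ∫ z, η z ∂μ = 0) {c : ℝ}
    (hc : ∫ z, η z ^ 2 ∂μ ≤ c * ∫ z, a z ∂μ) (hc0 : 0 ≤ c) :
    ∫ S, (∑ k, η (S k)) ^ 2 / ((∑ k, a (S k)) + 2) ^ 2 ∂(Measure.pi fun _ : Fin t => μ) ≤
      c * ∫ S, 1 / ((∑ k, a (S k)) + 1) ∂(Measure.pi fun _ : Fin t => μ) := by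
  have h0 : ∀ z, 0 ≤ a z := fun z => by rcases h01 z with h | h <;> simp [h]
  have hn : ∀ S : Fin t → α, 0 ≤ ∑ k, a (S k) := fun S => Finset.sum_nonneg fun _ _ => h0 _
  have hcount := measurable_sum_sample (t := t) ha
  have hmk : ∀ k : Fin t, Measurable fun S : Fin t → α => η (S k) :=
    fun k => hη.comp (measurable_pi_apply k)
  have hint : ∀ i j : Fin t, Integrable
      (fun S => η (S i) * (η (S j) / ((∑ k, a (S k)) + 2) ^ 2))
      (Measure.pi fun _ : Fin t => μ) := by
    intro i j
    refine Integrable.of_bound (C := 1)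
      (((hmk i).mul ((hmk j).div ((hcount.add_const 2).pow_const 2))).aestronglyMeasurable)
      (Filter.Eventually.of_forall fun S => ?_)
    have h1 := hn S
    rw [Real.norm_eq_abs, abs_mul, abs_div, abs_of_nonneg (a := (_ + 2) ^ 2) (by positivity)]
    refine mul_le_one₀ (hη1 _) (by positivity) ?_
    rw [div_le_one (by positivity)]
    nlinarith [hη1 (S j)]
  -- Where η(S i) ≠ 0 the point i is counted, so count + 2 may be replaced by the sum over the
  -- others + 3. The denominator no longer involves the point i, and the factor η(S i) integrates to
  -- zero.
  have hcross : ∀ i j : Fin t, j ≠ i →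
      ∫ S, η (S i) * (η (S j) / ((∑ k, a (S k)) + 2) ^ 2) ∂(Measure.pi fun _ : Fin t => μ) = 0 := by
    intro i j hij
    have e : ∀ S : Fin t → α, η (S i) * (η (S j) / ((∑ k, a (S k)) + 2) ^ 2) =
        η (S i) * (η (S j) / (sumOthers a i S + 3) ^ 2) := by
      intro S
      rcases h01 (S i) with h | h
      · simp [hηa _ h]
      · rw [← add_sumOthers a i S, h]; congr 3; ring
    simp_rw [e]
    rw [integral_pi_mul_of_update_eq i η (fun S => η (S j) / (sumOthers a i S + 3) ^ 2), hmean,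
      zero_mul]
    intro S z
    rw [sumOthers_update, Function.update_of_ne hij]
  have hinta : ∀ i : Fin t, Integrable (fun S => a (S i) * (1 / ((∑ k, a (S k)) + 2) ^ 2))
      (Measure.pi fun _ : Fin t => μ) := by
    intro i
    refine Integrable.of_bound (C := 1)
      (((ha.comp (measurable_pi_apply i)).mul
        (measurable_const.div ((hcount.add_const 2).pow_const 2))).aestronglyMeasurable)
      (Filter.Eventually.of_forall fun S => ?_)
    have h1 := hn S
    have h2 := h0 (S i)
    rw [Real.norm_of_nonneg (by positivity)]
    refine mul_le_one₀ (by rcases h01 (S i) with h | h <;> simp [h]) (by positivity) ?_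
    rw [div_le_one (by positivity)]
    nlinarith
  -- The same replacement on both sides frees the denominator of the point i, so that the variance
  -- hypothesis on η applies to a factor that splits off.
  have hdiag : ∀ i : Fin t,
      ∫ S, η (S i) * (η (S i) / ((∑ k, a (S k)) + 2) ^ 2) ∂(Measure.pi fun _ : Fin t => μ) ≤
      c * ∫ S, a (S i) * (1 / ((∑ k, a (S k)) + 2) ^ 2) ∂(Measure.pi fun _ : Fin t => μ) := by
    intro i
    have e : ∀ S : Fin t → α, η (S i) * (η (S i) / ((∑ k, a (S k)) + 2) ^ 2) =
        η (S i) ^ 2 * (1 / (sumOthers a i S + 3) ^ 2) := by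
      intro S
      rcases h01 (S i) with h | h
      · simp [hηa _ h]
      · rw [← add_sumOthers a i S, h, show 1 + sumOthers a i S + 2 = sumOthers a i S + 3 by ring]
        ring
    have e' : ∀ S : Fin t → α, a (S i) * (1 / ((∑ k, a (S k)) + 2) ^ 2) =
        a (S i) * (1 / (sumOthers a i S + 3) ^ 2) := by
      intro S
      rcases h01 (S i) with h | h
      · simp [h]
      · rw [← add_sumOthers a i S, h, show 1 + sumOthers a i S + 2 = sumOthers a i S + 3 by ring]
    simp_rw [e, e']
    rw [integral_pi_mul_of_update_eq i (fun z => η z ^ 2)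
        (fun S => 1 / (sumOthers a i S + 3) ^ 2) (fun S z => by rw [sumOthers_update]),
      integral_pi_mul_of_update_eq i a
        (fun S => 1 / (sumOthers a i S + 3) ^ 2) (fun S z => by rw [sumOthers_update]), ← mul_assoc]
    refine mul_le_mul_of_nonneg_right hc (integral_nonneg fun S => ?_)
    show 0 ≤ 1 / (sumOthers a i S + 3) ^ 2
    positivity
  have hexp : ∀ S : Fin t → α, (∑ k, η (S k)) ^ 2 / ((∑ k, a (S k)) + 2) ^ 2 =
      ∑ i, ∑ j, η (S i) * (η (S j) / ((∑ k, a (S k)) + 2) ^ 2) := by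
    intro S
    simp_rw [← Finset.mul_sum, ← Finset.sum_div]
    rw [← Finset.sum_mul]
    ring
  simp_rw [hexp]
  rw [integral_finsetSum _ fun i _ => integrable_finsetSum _ fun j _ => hint i j]
  have hrow : ∀ i : Fin t, ∫ S, ∑ j, η (S i) * (η (S j) / ((∑ k, a (S k)) + 2) ^ 2)
      ∂(Measure.pi fun _ : Fin t => μ) ≤
      c * ∫ S, a (S i) * (1 / ((∑ k, a (S k)) + 2) ^ 2) ∂(Measure.pi fun _ : Fin t => μ) := by
    intro i
    rw [integral_finsetSum _ fun j _ => hint i j,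
      Finset.sum_eq_single i (fun j _ hj => hcross i j hj) (by simp)]
    exact hdiag i
  refine (Finset.sum_le_sum fun i _ => hrow i).trans ?_
  rw [← Finset.mul_sum, ← integral_finsetSum _ fun i _ => hinta i]
  refine mul_le_mul_of_nonneg_left (integral_mono (integrable_finsetSum _ fun i _ => hinta i)
    ?_ fun S => ?_) hc0
  · refine Integrable.of_bound (C := 1)
      ((measurable_const.div (hcount.add_const 1)).aestronglyMeasurable)
      (Filter.Eventually.of_forall fun S => ?_)
    have := hn S
    rw [Real.norm_of_nonneg (by positivity), div_le_one (by positivity)]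
    linarith
  · have := hn S
    show ∑ i, a (S i) * (1 / ((∑ k, a (S k)) + 2) ^ 2) ≤ 1 / ((∑ k, a (S k)) + 1)
    rw [← Finset.sum_mul, mul_one_div, div_le_div_iff₀ (by positivity) (by positivity)]
    nlinarith

end IndependentSample

/-! ### Moments of a single experiment -/

section Experiment

variable {d : ℕ} {π : Cube d → ℝ} {B : ℝ}

lemma successProb_nonneg (hB : 0 ≤ B) (hB1 : B < 1) {x : Cube d} (h : 0 < π x) :
    0 ≤ successProb π B x := by
  have : 0 ≤ (1 - B) * π x := mul_nonneg (by linarith) h.le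
  unfold successProb; linarith

lemma one_sub_successProb (π : Cube d → ℝ) (B : ℝ) (x : Cube d) :
    1 - successProb π B x = (1 - B) * (1 - π x) := by
  unfold successProb; ring

lemma one_sub_successProb_nonneg (hB1 : B < 1) {x : Cube d} (h : π x ≤ 1) :
    0 ≤ 1 - successProb π B x := by
  rw [one_sub_successProb]
  exact mul_nonneg (by linarith) (by linarith)

lemma measurable_successProb (hm : Measurable π) : Measurable (successProb π B) := by
  unfold successProb; fun_prop

lemma measurable_experimentDensity (hm : Measurable π) :
    Measurable fun z : Cube d × Bool =>
      if z.2 = true then successProb π B z.1 else 1 - successProb π B z.1 := by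
  have h := measurable_successProb (B := B) hm
  exact Measurable.ite (measurable_snd (measurableSet_singleton true)) (by fun_prop) (by fun_prop)

lemma isProbabilityMeasure_experimentLaw (hB : 0 ≤ B) (hB1 : B < 1) (hm : Measurable π)
    (hπ : ∀ x, 0 < π x ∧ π x ≤ 1) : IsProbabilityMeasure (experimentLaw π B) := by
  constructor
  rw [experimentLaw, withDensity_apply _ MeasurableSet.univ, setLIntegral_univ,
    lintegral_prod _ (measurable_experimentDensity hm).ennreal_ofReal.aemeasurable]
  simp only [lintegral_count, tsum_fintype, Fintype.sum_bool, if_true, Bool.false_eq_true, if_false]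
  have : ∀ x, ENNReal.ofReal (successProb π B x) + ENNReal.ofReal (1 - successProb π B x) = 1 := by
    intro x
    rw [← ENNReal.ofReal_add (successProb_nonneg hB hB1 (hπ x).1)
      (one_sub_successProb_nonneg hB1 (hπ x).2)]
    simp
  simp [this]

lemma integral_experimentLaw (hB : 0 ≤ B) (hB1 : B < 1) (hm : Measurable π)
    (hπ : ∀ x, 0 < π x ∧ π x ≤ 1) {f : Cube d × Bool → ℝ} (hf : Measurable f)
    (hf1 : ∀ z, |f z| ≤ 1) :
    ∫ z, f z ∂(experimentLaw π B) =
      ∫ x, (successProb π B x * f (x, true) + (1 - successProb π B x) * f (x, false)) := by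
  have hw := measurable_experimentDensity (B := B) hm
  have h0 : ∀ z : Cube d × Bool,
      0 ≤ if z.2 = true then successProb π B z.1 else 1 - successProb π B z.1 := by
    intro z
    split_ifs
    · exact successProb_nonneg hB hB1 (hπ _).1
    · exact one_sub_successProb_nonneg hB1 (hπ _).2
  have h1 : ∀ z : Cube d × Bool,
      (if z.2 = true then successProb π B z.1 else 1 - successProb π B z.1) ≤ 1 := by
    intro z
    split_ifs
    · linarith [one_sub_successProb_nonneg (B := B) hB1 (hπ z.1).2]
    · linarith [successProb_nonneg hB hB1 (hπ z.1).1]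
  rw [experimentLaw, integral_withDensity_eq_integral_toReal_smul hw.ennreal_ofReal
    (Filter.Eventually.of_forall fun _ => ENNReal.ofReal_lt_top)]
  simp_rw [ENNReal.toReal_ofReal (h0 _), smul_eq_mul]
  rw [integral_prod]
  · simp [integral_count]
  · refine Integrable.of_bound (C := 1) (hw.mul hf).aestronglyMeasurable
      (Filter.Eventually.of_forall fun z => ?_)
    rw [Real.norm_eq_abs, abs_mul, abs_of_nonneg (h0 z)]
    exact mul_le_one₀ (h1 z) (abs_nonneg _) (hf1 z)

/-- The indicator of the event that the test point lies in the box around `x`. -/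
noncomputable def nearIndicator (Δ : ℝ) (x : Cube d) (z : Cube d × Bool) : ℝ :=
  {y : Cube d | ∀ j, |x.vec j - y.vec j| ≤ Δ}.indicator 1 z.1

/-- The centered indicator of a failure near `x`. -/
noncomputable def failureNoise (π : Cube d → ℝ) (B Δ : ℝ) (x : Cube d) (z : Cube d × Bool) : ℝ :=
  nearIndicator Δ x z * ((if z.2 = true then 0 else 1) - (1 - B) * (1 - π z.1))

lemma measurable_coord (j : Fin d) : Measurable fun y : Cube d => y.vec j := by
  unfold Cube.vec; fun_prop

lemma measurableSet_box (Δ : ℝ) (x : Cube d) :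
    MeasurableSet {y : Cube d | ∀ j, |x.vec j - y.vec j| ≤ Δ} := by
  rw [Set.ofPred_forall]
  refine MeasurableSet.iInter fun j => ?_
  exact measurableSet_le (((measurable_coord j).const_sub _).abs) measurable_const

lemma nearIndicator_eq_zero_or_one (Δ : ℝ) (x : Cube d) (z : Cube d × Bool) :
    nearIndicator Δ x z = 0 ∨ nearIndicator Δ x z = 1 := by
  unfold nearIndicator
  by_cases h : z.1 ∈ {y : Cube d | ∀ j, |x.vec j - y.vec j| ≤ Δ}
  · right; simp only [Set.indicator_of_mem h, Pi.one_apply]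
  · left; simp only [Set.indicator_of_notMem h]

lemma measurable_nearIndicator (Δ : ℝ) (x : Cube d) : Measurable (nearIndicator Δ x) :=
  (measurable_one.indicator (measurableSet_box Δ x)).comp measurable_fst

lemma measurable_failureNoise (hm : Measurable π) (B Δ : ℝ) (x : Cube d) :
    Measurable (failureNoise π B Δ x) := by
  refine (measurable_nearIndicator Δ x).mul (Measurable.sub ?_ (by fun_prop))
  exact Measurable.ite (measurable_snd (measurableSet_singleton true)) (by fun_prop) (by fun_prop)

lemma abs_failureNoise_le_one (hB : 0 ≤ B) (hB1 : B < 1) (hπ : ∀ x, 0 < π x ∧ π x ≤ 1) (Δ : ℝ)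
    (x : Cube d) (z : Cube d × Bool) : |failureNoise π B Δ x z| ≤ 1 := by
  have h1 := successProb_nonneg hB hB1 (hπ z.1).1
  have h2 := one_sub_successProb_nonneg (B := B) hB1 (hπ z.1).2
  rw [failureNoise, ← one_sub_successProb]
  rcases nearIndicator_eq_zero_or_one Δ x z with h | h
  · simp [h]
  · rw [h, one_mul, abs_le]
    split_ifs <;> constructor <;> linarith

lemma integral_nearIndicator (hB : 0 ≤ B) (hB1 : B < 1) (hm : Measurable π)
    (hπ : ∀ x, 0 < π x ∧ π x ≤ 1) (Δ : ℝ) (x : Cube d) :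
    ∫ z, nearIndicator Δ x z ∂(experimentLaw π B) =
      volume.real {y : Cube d | ∀ j, |x.vec j - y.vec j| ≤ Δ} := by
  rw [integral_experimentLaw hB hB1 hm hπ (measurable_nearIndicator Δ x) fun z => by
    rcases nearIndicator_eq_zero_or_one Δ x z with h | h <;> simp [h],
    ← integral_indicator_one (measurableSet_box Δ x)]
  refine integral_congr_ae (Filter.Eventually.of_forall fun y => ?_)
  simp only [nearIndicator]
  ring

lemma integral_failureNoise (hB : 0 ≤ B) (hB1 : B < 1) (hm : Measurable π)
    (hπ : ∀ x, 0 < π x ∧ π x ≤ 1) (Δ : ℝ) (x : Cube d) :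
    ∫ z, failureNoise π B Δ x z ∂(experimentLaw π B) = 0 := by
  rw [integral_experimentLaw hB hB1 hm hπ (measurable_failureNoise hm B Δ x)
    (abs_failureNoise_le_one hB hB1 hπ Δ x), ← integral_zero (Cube d) ℝ]
  refine integral_congr_ae (Filter.Eventually.of_forall fun y => ?_)
  simp only [failureNoise, nearIndicator, successProb, if_true, Bool.false_eq_true, if_false]
  ring

/-- On the box the conditional variance is that of a Bernoulli variable, p(1 − p), and the failure
probability satisfies 1 − p = (1 − B)(1 − π) ≤ 1 − B. This factor 1 − B saves one power of 1/(1 − B)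
in the final rate. -/
lemma integral_failureNoise_sq_le (hB : 0 ≤ B) (hB1 : B < 1) (hm : Measurable π)
    (hπ : ∀ x, 0 < π x ∧ π x ≤ 1) (Δ : ℝ) (x : Cube d) :
    ∫ z, failureNoise π B Δ x z ^ 2 ∂(experimentLaw π B) ≤
      (1 - B) * ∫ z, nearIndicator Δ x z ∂(experimentLaw π B) := by
  rw [integral_nearIndicator hB hB1 hm hπ, integral_experimentLaw hB hB1 hm hπ
    ((measurable_failureNoise hm B Δ x).pow_const 2) fun z => by
      rw [abs_pow]
      exact pow_le_one₀ (abs_nonneg _) (abs_failureNoise_le_one hB hB1 hπ Δ x z),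
    ← integral_indicator_one (measurableSet_box Δ x), ← integral_const_mul]
  have hpoint : ∀ y, successProb π B y * failureNoise π B Δ x (y, true) ^ 2 +
      (1 - successProb π B y) * failureNoise π B Δ x (y, false) ^ 2 =
      {y : Cube d | ∀ j, |x.vec j - y.vec j| ≤ Δ}.indicator 1 y *
        (successProb π B y * (1 - successProb π B y)) := by
    intro y
    have e : failureNoise π B Δ x (y, true) ^ 2 = nearIndicator Δ x (y, true) *
        (1 - successProb π B y) ^ 2 := by
      rw [failureNoise, ← one_sub_successProb]
      rcases nearIndicator_eq_zero_or_one Δ x (y, true) with h | h <;> rw [h]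
      · simp
      · simp only [if_true]; ring
    have e' : failureNoise π B Δ x (y, false) ^ 2 = nearIndicator Δ x (y, true) *
        (successProb π B y) ^ 2 := by
      rw [failureNoise, ← one_sub_successProb]
      change (nearIndicator Δ x (y, true) * _) ^ 2 = _
      rcases nearIndicator_eq_zero_or_one Δ x (y, true) with h | h <;> rw [h] <;> simp
    rw [e, e', show {y : Cube d | ∀ j, |x.vec j - y.vec j| ≤ Δ}.indicator 1 y =
      nearIndicator Δ x (y, true) from rfl]
    ring
  refine integral_mono_of_nonneg (Filter.Eventually.of_forall fun y => ?_)
    ((integrable_indicator_iff (measurableSet_box Δ x)).2 (integrable_const 1).integrableOn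
      |>.const_mul _) (Filter.Eventually.of_forall fun y => ?_)
  · have h1 := successProb_nonneg hB hB1 (hπ y).1
    have h2 := one_sub_successProb_nonneg (B := B) hB1 (hπ y).2
    show 0 ≤ _ * _ + _ * _
    positivity
  · show _ * _ + _ * _ ≤ _ * _
    rw [hpoint, mul_comm]
    refine mul_le_mul_of_nonneg_right ?_ (Set.indicator_nonneg (fun _ _ => zero_le_one) _)
    have h1 := successProb_nonneg hB hB1 (hπ y).1
    have h2 := one_sub_successProb_nonneg (B := B) hB1 (hπ y).2
    have h3 : 1 - successProb π B y ≤ 1 - B := by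
      rw [one_sub_successProb]
      nlinarith [(hπ y).1]
    nlinarith

end Experiment

/-! ### Counts as sums over the sample -/

section Counts

variable {d t : ℕ}

lemma numSucc_le_numNear (Δ : ℝ) (S : Data d t) (x : Cube d) : numSucc Δ S x ≤ numNear Δ S x :=
  Finset.card_filter_le _ _

lemma nearIndicator_eq_ite (Δ : ℝ) (S : Data d t) (x : Cube d) (i : Fin t)
    [Decidable (i ∈ neighbors Δ S x)] :
    nearIndicator Δ x (S i) = if i ∈ neighbors Δ S x then 1 else 0 := by
  simp [nearIndicator, Set.indicator_apply, neighbors]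

lemma numNear_eq_sum (Δ : ℝ) (S : Data d t) (x : Cube d) :
    (numNear Δ S x : ℝ) = ∑ i, nearIndicator Δ x (S i) := by
  classical
  simp_rw [nearIndicator_eq_ite]
  simp [numNear]

lemma failures_eq_sum (Δ : ℝ) (S : Data d t) (x : Cube d) :
    ((numNear Δ S x - numSucc Δ S x : ℕ) : ℝ) =
      ∑ i, nearIndicator Δ x (S i) * (if (S i).2 = true then 0 else 1) := by
  classical
  have h : numNear Δ S x - numSucc Δ S x =
      ((neighbors Δ S x).filter fun i => ¬ (S i).2 = true).card := by
    have := Finset.card_filter_add_card_filter_not (s := neighbors Δ S x)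
      (fun i => (S i).2 = true)
    rw [numNear, numSucc]
    omega
  rw [h, Finset.card_filter, Nat.cast_sum, ← Finset.sum_subset (Finset.subset_univ _)]
  · refine Finset.sum_congr rfl fun i hi => ?_
    rw [nearIndicator_eq_ite, if_pos hi]
    by_cases hs : (S i).2 = true <;> simp [hs]
  · intro i _ hi
    rw [nearIndicator_eq_ite, if_neg hi, zero_mul]

end Counts

/-! ### Bias, noise and prior: the risk at one query point -/

section Risk

variable {d t : ℕ} {π : Cube d → ℝ} {B : ℝ}

/-- The square error of the posterior is controlled by the bias of the tests near `x`, the noise,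
and the number of tests near `x`. -/
lemma lintegral_sq_posterior_le (hB : 0 ≤ B) (hB1 : B < 1) (hπ : ∀ x, 0 < π x ∧ π x ≤ 1)
    {Δ ε : ℝ} (hε0 : 0 ≤ ε) {x : Cube d}
    (hε : ∀ y : Cube d, (∀ j, |x.vec j - y.vec j| ≤ Δ) → |π x - π y| ≤ ε) (S : Data d t) :
    ∫⁻ θ, ENNReal.ofReal ((θ - π x) ^ 2) ∂(posterior 1 1 B Δ S x) ≤
      ENNReal.ofReal (3 * ε ^ 2 + 3 / (1 - B) ^ 2 *
        ((∑ i, failureNoise π B Δ x (S i)) ^ 2 / ((∑ i, nearIndicator Δ x (S i)) + 2) ^ 2) +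
        5 / (1 - B) * (1 / ((∑ i, nearIndicator Δ x (S i)) + 1))) := by
  obtain ⟨r, hr⟩ := Nat.exists_eq_add_of_le (numSucc_le_numNear Δ S x)
  have hrsum := failures_eq_sum Δ S x
  rw [show numNear Δ S x - numSucc Δ S x = r by omega] at hrsum
  have hnsum := numNear_eq_sum Δ S x
  rw [posterior]
  have hpost := lintegral_sq_betaMixture_le hB hB1 (numSucc Δ S x) r (hπ x).1.le (hπ x).2
  rw [← hr, hnsum] at hpost
  rw [hr] at *
  refine hpost.trans (ENNReal.ofReal_le_ofReal ?_)
  set n : ℝ := ∑ i, nearIndicator Δ x (S i) with hn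
  set Z : ℝ := ∑ i, failureNoise π B Δ x (S i) with hZ
  set c : ℝ := 1 - B with hc
  have hc0 : 0 < c := by rw [hc]; linarith
  have hc1 : c ≤ 1 := by rw [hc]; linarith
  have hn0 : 0 ≤ n := by rw [← hnsum]; positivity
  have hM : 0 < c * (n + 2) := by positivity
  have hM1 : 1 / (c * (n + 2)) ≤ 1 / c * (1 / (n + 1)) := by
    rw [← one_div_mul_one_div]
    refine mul_le_mul_of_nonneg_left (one_div_le_one_div_of_le ?_ ?_) ?_ <;>
      first | positivity | linarith
  have e5 : 5 / c * (1 / (n + 1)) = 5 * (1 / c * (1 / (n + 1))) := by ring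
  have eZ : 3 / c ^ 2 * (Z ^ 2 / (n + 2) ^ 2) = 3 * (Z / (c * (n + 2))) ^ 2 := by
    field_simp
  rw [e5, eZ]
  have hpos : 0 ≤ 1 / (c * (n + 2)) := by positivity
  -- If (1 − B)(n + 2) ≤ 1, the trivial bound 1 on the square error is already dominated by the last
  -- term. Otherwise 1/((1 − B)(n + 2)) < 1, which lets the square of the prior term be bounded by
  -- its first power.
  rcases le_or_gt 1 (1 / (c * (n + 2))) with h | h
  · refine (min_le_left _ _).trans ?_
    nlinarith [sq_nonneg ε, sq_nonneg (Z / (c * (n + 2)))]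
  · refine (min_le_right _ _).trans ?_
    set D : ℝ := ∑ i, nearIndicator Δ x (S i) * (π (S i).1 - π x) with hD
    have hr' : (r : ℝ) = Z + c * (n * (1 - π x) - D) := by
      rw [hrsum, hZ, hD, hn, Finset.sum_mul, ← Finset.sum_sub_distrib, Finset.mul_sum,
        ← Finset.sum_add_distrib]
      refine Finset.sum_congr rfl fun i _ => ?_
      rw [failureNoise]
      ring
    have hDabs : |D| ≤ n * ε := by
      rw [hD, hn, Finset.sum_mul]
      refine (Finset.abs_sum_le_sum_abs _ _).trans (Finset.sum_le_sum fun i _ => ?_)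
      classical
      have hi := nearIndicator_eq_ite Δ S x i
      split_ifs at hi with h
      · rw [hi, one_mul, one_mul, abs_sub_comm]
        exact hε _ (by simpa [neighbors] using h)
      · simp [hi]
    -- The error of the center is u − v + w: bias, noise, and the effect of the prior's
    -- pseudo-counts. With (u − v + w)² ≤ 3(u² + v² + w²), the constant 5 is 3 from w² plus 2 from
    -- the posterior spread 2/(c(n + 2)).
    set u : ℝ := D / (n + 2) with hu
    set v : ℝ := Z / (c * (n + 2)) with hv
    set w : ℝ := (2 * c * (1 - π x) - 1) * (1 / (c * (n + 2))) with hw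
    have hsplit : 1 - ((r : ℝ) + 1) / (c * (n + 2)) - π x = u - v + w := by
      rw [hr', hu, hv, hw]
      field_simp
      ring
    have hu2 : u ^ 2 ≤ ε ^ 2 := by
      have h2 : |u| ≤ ε := by
        rw [hu, abs_div, abs_of_pos (show (0 : ℝ) < n + 2 by positivity),
          div_le_iff₀ (by positivity)]
        nlinarith
      exact sq_le_sq' (abs_le.1 h2).1 (abs_le.1 h2).2
    have hw2 : w ^ 2 ≤ 1 / (c * (n + 2)) := by
      have h1 : (2 * c * (1 - π x) - 1) ^ 2 ≤ 1 := by
        have := (hπ x).1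
        have := (hπ x).2
        have h2 : c * (1 - π x) ≤ 1 := by nlinarith
        have h3 : 0 ≤ c * (1 - π x) := mul_nonneg hc0.le (by linarith)
        rw [sq_le_one_iff_abs_le_one, abs_le]
        constructor <;> linarith
      rw [hw, mul_pow]
      refine (mul_le_of_le_one_left (sq_nonneg _) h1).trans ?_
      rw [sq]
      exact mul_le_of_le_one_left hpos h.le
    rw [hsplit]
    have e2 : 2 / (c * (n + 2)) = 2 * (1 / (c * (n + 2))) := by ring
    rw [e2]
    have h3 : (u - v + w) ^ 2 ≤ 3 * (u ^ 2 + v ^ 2 + w ^ 2) := by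
      nlinarith only [sq_nonneg (u + v), sq_nonneg (v + w), sq_nonneg (u - w)]
    linarith

/-- Integrates the pointwise bound over the sample. Noise and count terms both reduce to E[1/(n +
1)] ≤ 1/(tq), with constants 3 and 5 that add up to 8. -/
lemma meanSquareError_le (hB : 0 ≤ B) (hB1 : B < 1) (hm : Measurable π)
    (hπ : ∀ x, 0 < π x ∧ π x ≤ 1) {Δ ε q : ℝ} (hε0 : 0 ≤ ε) {x : Cube d}
    (hε : ∀ y : Cube d, (∀ j, |x.vec j - y.vec j| ≤ Δ) → |π x - π y| ≤ ε) (hq : 0 < q)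
    (hvol : q ≤ volume.real {y : Cube d | ∀ j, |x.vec j - y.vec j| ≤ Δ}) (ht : 0 < t) :
    meanSquareError π B Δ t x ≤ ENNReal.ofReal (3 * ε ^ 2 + 8 / ((1 - B) * t * q)) := by
  have hc0 : 0 < 1 - B := by linarith
  have ht' : (0 : ℝ) < t := by exact_mod_cast ht
  have := isProbabilityMeasure_experimentLaw hB hB1 hm hπ
  have ha := measurable_nearIndicator (d := d) Δ x
  have h01 := nearIndicator_eq_zero_or_one (d := d) Δ x
  have ha0 : ∀ z, 0 ≤ nearIndicator Δ x z := fun z => by rcases h01 z with h | h <;> simp [h]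
  have hη := measurable_failureNoise hm B Δ x
  have hη1 := abs_failureNoise_le_one hB hB1 hπ Δ x
  have hη0 : ∀ z, nearIndicator Δ x z = 0 → failureNoise π B Δ x z = 0 := by
    intro z hz
    rw [failureNoise, hz, zero_mul]
  have hηa : ∀ z, |failureNoise π B Δ x z| ≤ nearIndicator Δ x z := by
    intro z
    rcases h01 z with h | h
    · simp [h, hη0 z h]
    · rw [h]; exact hη1 z
  have hinv := integral_inv_count_le (μ := experimentLaw π B) (t := t) ha h01
  have hnoise := integral_sq_sum_div_le (μ := experimentLaw π B) (t := t) ha h01 hη hη1 hη0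
    (integral_failureNoise hB hB1 hm hπ Δ x) (integral_failureNoise_sq_le hB hB1 hm hπ Δ x) hc0.le
  rw [integral_nearIndicator hB hB1 hm hπ] at hinv
  have hn : ∀ S : Data d t, 0 ≤ ∑ k, nearIndicator Δ x (S k) :=
    fun S => Finset.sum_nonneg fun _ _ => ha0 _
  have hcount := measurable_sum_sample (t := t) ha
  have hZ := measurable_sum_sample (t := t) hη
  have hint1 : Integrable (fun S : Data d t => 1 / ((∑ k, nearIndicator Δ x (S k)) + 1))
      (Measure.pi fun _ => experimentLaw π B) := by
    refine Integrable.of_bound (C := 1)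
      ((measurable_const.div (hcount.add_const 1)).aestronglyMeasurable)
      (Filter.Eventually.of_forall fun S => ?_)
    have := hn S
    rw [Real.norm_of_nonneg (by positivity), div_le_one (by positivity)]
    linarith
  have hint2 : Integrable (fun S : Data d t => (∑ k, failureNoise π B Δ x (S k)) ^ 2 /
      ((∑ k, nearIndicator Δ x (S k)) + 2) ^ 2) (Measure.pi fun _ => experimentLaw π B) := by
    refine Integrable.of_bound (C := 1)
      (((hZ.pow_const 2).div ((hcount.add_const 2).pow_const 2)).aestronglyMeasurable)
      (Filter.Eventually.of_forall fun S => ?_)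
    have h1 := hn S
    rw [Real.norm_of_nonneg (by positivity), div_le_one (by positivity)]
    have h2 : |∑ k, failureNoise π B Δ x (S k)| ≤ ∑ k, nearIndicator Δ x (S k) :=
      (Finset.abs_sum_le_sum_abs _ _).trans (Finset.sum_le_sum fun i _ => hηa _)
    rw [← sq_abs]
    exact pow_le_pow_left₀ (abs_nonneg _) (by linarith) 2
  rw [meanSquareError, dataLaw]
  refine (lintegral_mono fun S => lintegral_sq_posterior_le hB hB1 hπ hε0 hε S).trans ?_
  rw [← ofReal_integral_eq_lintegral_ofReal]
  · refine ENNReal.ofReal_le_ofReal ?_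
    rw [integral_add (by fun_prop) (by fun_prop), integral_add (by fun_prop) (by fun_prop),
      integral_const, probReal_univ, one_smul, integral_const_mul, integral_const_mul]
    set E := ∫ S : Data d t, 1 / ((∑ k, nearIndicator Δ x (S k)) + 1)
      ∂(Measure.pi fun _ => experimentLaw π B)
    have hE : 0 ≤ E := integral_nonneg fun S => by
      have := hn S
      show 0 ≤ 1 / ((∑ k, nearIndicator Δ x (S k)) + 1)
      positivity
    have hE1 : E ≤ 1 / (t * q) := by
      rw [le_div_iff₀ (by positivity)]
      refine le_trans ?_ hinv
      rw [mul_comm]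
      gcongr
    -- The noise variance contributes one factor 1 − B, cancelling one of the two in the
    -- denominator.
    have h1 : 3 / (1 - B) ^ 2 * ((1 - B) * E) = 3 / (1 - B) * E := by field_simp
    have h2 := mul_le_mul_of_nonneg_left hnoise (show 0 ≤ 3 / (1 - B) ^ 2 by positivity)
    rw [h1] at h2
    have h3 := mul_le_mul_of_nonneg_left hE1 (show 0 ≤ 8 / (1 - B) by positivity)
    have h4 : 8 / (1 - B) * (1 / (t * q)) = 8 / ((1 - B) * t * q) := by field_simp
    have h5 : 8 / (1 - B) * E = 3 / (1 - B) * E + 5 / (1 - B) * E := by ring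
    linarith
  · fun_prop
  · refine Filter.Eventually.of_forall fun S => ?_
    have := hn S
    show 0 ≤ _ + _ * (_ / _) + _ * (1 / _)
    positivity

end Risk

/-! ### Volume of a box and oscillation of π on it -/

section Box

variable {d : ℕ}

/-- The window is cut by at most one half near an end of [0,1]: its length 2Δ may drop to Δ, and if
it is cut at both ends it is all of [0,1]. -/
lemma min_one_le_volume_interval {Δ : ℝ} (hΔ : 0 < Δ) (x : unitInterval) :
    ENNReal.ofReal (min Δ 1) ≤ volume {y : unitInterval | |(x : ℝ) - y| ≤ Δ} := by
  have hx0 := x.2.1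
  have hx1 := x.2.2
  let l : unitInterval := ⟨max 0 (x - Δ), le_max_left _ _, max_le zero_le_one (by linarith)⟩
  let u : unitInterval := ⟨min 1 (x + Δ), le_min zero_le_one (by linarith), min_le_left _ _⟩
  have hsub : Set.Icc l u ⊆ {y : unitInterval | |(x : ℝ) - y| ≤ Δ} := by
    rintro y ⟨h1, h2⟩
    have h1' : max 0 ((x : ℝ) - Δ) ≤ y := h1
    have h2' : (y : ℝ) ≤ min 1 ((x : ℝ) + Δ) := h2
    have h3 := (le_max_right 0 ((x : ℝ) - Δ)).trans h1'
    have h4 := h2'.trans (min_le_right 1 ((x : ℝ) + Δ))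
    show |(x : ℝ) - y| ≤ Δ
    rw [abs_le]
    constructor <;> linarith
  refine le_trans ?_ (measure_mono hsub)
  rw [unitInterval.volume_Icc]
  refine ENNReal.ofReal_le_ofReal ?_
  show min Δ 1 ≤ min 1 ((x : ℝ) + Δ) - max 0 (x - Δ)
  rcases le_total 0 ((x : ℝ) - Δ) with h | h <;> rcases le_total 1 ((x : ℝ) + Δ) with h' | h' <;>
    rcases le_total Δ 1 with h'' | h'' <;> simp only [min_eq_left, min_eq_right, max_eq_left,
      max_eq_right, h, h', h''] <;> linarith

/-- A box around a point of the cube fills a fixed proportion of the volume. -/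
lemma pow_le_volume_box {Δ : ℝ} (hΔ : 0 < Δ) (x : Cube d) :
    min Δ 1 ^ d ≤ volume.real {y : Cube d | ∀ j, |x.vec j - y.vec j| ≤ Δ} := by
  have e : {y : Cube d | ∀ j, |x.vec j - y.vec j| ≤ Δ} =
      Set.univ.pi fun j => {y : unitInterval | |(x j : ℝ) - y| ≤ Δ} := by
    ext y; simp [Cube.vec]
  have h0 : 0 ≤ min Δ 1 := le_min hΔ.le zero_le_one
  rw [measureReal_def, ← ENNReal.ofReal_le_iff_le_toReal (measure_ne_top _ _), e, volume_pi_pi,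
    ENNReal.ofReal_pow h0]
  calc ENNReal.ofReal (min Δ 1) ^ d = ∏ _j : Fin d, ENNReal.ofReal (min Δ 1) := by simp
    _ ≤ _ := Finset.prod_le_prod' fun j _ => min_one_le_volume_interval hΔ (x j)

end Box

section Smoothness

variable {d : ℕ}

/-- Expanding v in the standard basis compares N with the sup norm that defines the box. The
constant depends only on d and N, as the final constant must. -/
lemma seminorm_le_sum_mul (N : Seminorm ℝ (Fin d → ℝ)) {v : Fin d → ℝ} {r : ℝ}
    (hv : ∀ j, |v j| ≤ r) : N v ≤ (∑ j, N (Pi.single j 1)) * r := by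
  have e : v = ∑ j, v j • (Pi.single j 1 : Fin d → ℝ) := by
    ext k
    simp [Finset.sum_apply, Pi.single_apply]
  calc N v = N (∑ j, v j • (Pi.single j 1 : Fin d → ℝ)) := by rw [← e]
    _ ≤ ∑ j, N (v j • (Pi.single j 1 : Fin d → ℝ)) :=
        Finset.le_sum_of_subadditive N (map_zero N).le (map_add_le_add N) _ _
    _ ≤ ∑ j, N (Pi.single j 1) * r := by
        refine Finset.sum_le_sum fun j _ => ?_
        rw [map_smul_eq_mul, Real.norm_eq_abs, mul_comm]
        exact mul_le_mul_of_nonneg_left (hv j) (apply_nonneg N _)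
    _ = _ := (Finset.sum_mul _ _ _).symm

lemma measurable_of_abs_sub_le (N : Seminorm ℝ (Fin d → ℝ)) {L : ℝ} (hL : 0 ≤ L)
    {π : Cube d → ℝ} (h : ∀ x y, |π x - π y| ≤ L * N (x.vec - y.vec)) : Measurable π := by
  have hA : 0 ≤ ∑ j, N (Pi.single j 1) := Finset.sum_nonneg fun j _ => apply_nonneg N _
  refine (LipschitzWith.of_dist_le_mul (K := ⟨L * ∑ j, N (Pi.single j 1), by positivity⟩)
    fun x y => ?_).continuous.measurable
  rw [Real.dist_eq]
  refine (h x y).trans ?_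
  show _ ≤ L * (∑ j, N (Pi.single j 1)) * dist x y
  rw [mul_assoc]
  refine mul_le_mul_of_nonneg_left (seminorm_le_sum_mul N fun j => ?_) hL
  exact dist_le_pi_dist x y j

end Smoothness

/-! ### The kernel width and the rate -/

/-- Expresses the width through the single root of L²(1 − B)t, which is both what the program
computes and the scale y of the rate proof. -/
lemma kernelWidth_eq (d : ℕ) {κ L B : ℝ} (hL : 0 < L) (hB1 : B < 1) (t : ℕ) :
    kernelWidth d κ L B t = κ / (L ^ 2 * ((1 - B) * t)) ^ (1 / ((d : ℝ) + 2)) := by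
  have hT : 0 ≤ (1 - B) * t := mul_nonneg (by linarith) (Nat.cast_nonneg t)
  rw [kernelWidth, Real.mul_rpow (by positivity) hT, ← Real.rpow_natCast L 2, ← Real.rpow_mul hL.le,
    neg_div, neg_div, Real.rpow_neg hL.le, Real.rpow_neg hT, mul_assoc, ← mul_inv,
    div_eq_mul_inv κ]
  congr 5
  push_cast
  ring

lemma rate_eq (d : ℕ) {L T : ℝ} (hL : 0 < L) (hT : 0 ≤ T) :
    L ^ (2 * (d : ℝ) / ((d : ℝ) + 2)) * T ^ (-(2 : ℝ) / ((d : ℝ) + 2)) =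
      L ^ 2 / ((L ^ 2 * T) ^ (1 / ((d : ℝ) + 2))) ^ 2 := by
  have hD : (d : ℝ) + 2 ≠ 0 := by positivity
  rw [← Real.rpow_mul_natCast (by positivity), Real.mul_rpow (by positivity) hT,
    ← Real.rpow_natCast L 2, ← Real.rpow_mul hL.le, neg_div, Real.rpow_neg hT, ← div_eq_mul_inv,
    ← div_div, ← Real.rpow_sub hL]
  congr 2
  · push_cast
    field_simp
    ring
  · push_cast
    ring

/-- The rate of convergence of the posterior. -/
theorem supMeanSquareError_kernelWidth_le (d : ℕ) (N : Seminorm ℝ (Fin d → ℝ)) {κ : ℝ}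
    (hκ : 0 < κ) : ∃ C : ℝ, 0 < C ∧ ∀ L B : ℝ, 0 < L → 0 ≤ B → B < 1 →
      ∀ π : Cube d → ℝ, (∀ x, 0 < π x ∧ π x ≤ 1) →
      (∀ x y, |π x - π y| ≤ L * N (x.vec - y.vec)) →
      ∀ t : ℕ, 1 ≤ L ^ 2 * ((1 - B) * t) →
        supMeanSquareError π B (kernelWidth d κ L B t) t ≤
          ENNReal.ofReal (C * (L ^ (2 * (d : ℝ) / ((d : ℝ) + 2)) *
            ((1 - B) * t) ^ (-(2 : ℝ) / ((d : ℝ) + 2)))) := by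
  set A : ℝ := ∑ j, N (Pi.single j 1) with hA
  have hA0 : 0 ≤ A := Finset.sum_nonneg fun j _ => apply_nonneg N _
  have hm : 0 < min κ 1 := lt_min hκ one_pos
  -- With Δ = κ/y and y^(d+2) = L²(1 − B)t, the squared bias is (LAκ/y)², and the variance term with
  -- q = (min κ 1 / y)^d is 8L²/(y² (min κ 1)^d). Both are multiples of the rate L²/y².
  refine ⟨3 * (A * κ) ^ 2 + 8 / min κ 1 ^ d, by positivity, ?_⟩
  intro L B hL hB hB1 π hπ hLip t hX
  have hc : 0 < 1 - B := by linarith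
  have ht : 0 < t := by
    rcases Nat.eq_zero_or_pos t with rfl | h
    · norm_num at hX
    · exact h
  have ht' : (0 : ℝ) < t := by exact_mod_cast ht
  have hT : 0 < (1 - B) * t := by positivity
  set y : ℝ := (L ^ 2 * ((1 - B) * t)) ^ (1 / ((d : ℝ) + 2)) with hy
  have hy1 : 1 ≤ y := Real.one_le_rpow hX (by positivity)
  have hy0 : 0 < y := by linarith
  have hyD : y ^ (d + 2) = L ^ 2 * ((1 - B) * t) := by
    rw [hy, ← Real.rpow_natCast, ← Real.rpow_mul (by positivity)]
    push_cast
    rw [one_div_mul_cancel (by positivity), Real.rpow_one]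
  rw [rate_eq d hL hT.le, ← hy, kernelWidth_eq d hL hB1, ← hy, supMeanSquareError]
  refine iSup_le fun x => ?_
  have hΔ : 0 < κ / y := by positivity
  -- Here y ≥ 1 is used, i.e. L²(1 − B)t ≥ 1: even for a large κ the box, capped at side 1, keeps a
  -- side of order 1/y.
  have hq : min κ 1 / y ≤ min (κ / y) 1 := by
    refine le_min (by gcongr; exact min_le_left _ _) ?_
    rw [div_le_one hy0]
    exact (min_le_right _ _).trans hy1
  have hvol : (min κ 1 / y) ^ d ≤
      volume.real {z : Cube d | ∀ j, |x.vec j - z.vec j| ≤ κ / y} :=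
    (pow_le_pow_left₀ (by positivity) hq d).trans (pow_le_volume_box hΔ x)
  have hε : ∀ z : Cube d, (∀ j, |x.vec j - z.vec j| ≤ κ / y) → |π x - π z| ≤ L * (A * (κ / y)) :=
    fun z hz => (hLip x z).trans
      (mul_le_mul_of_nonneg_left (seminorm_le_sum_mul N fun j => hz j) hL.le)
  refine (meanSquareError_le hB hB1 (measurable_of_abs_sub_le N hL.le hLip) hπ (by positivity) hε
    (by positivity) hvol ht).trans (ENNReal.ofReal_le_ofReal (le_of_eq ?_))
  have hT' : (1 - B) * t = y ^ (d + 2) / L ^ 2 := by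
    rw [hyD]; field_simp
  rw [hT', div_pow]
  field_simp
  ring

/-! ### Loop invariants on the random access machine -/

section Machine

lemma Store.nat_setNat {V A : Type} [DecidableEq V] (σ : Store V A) (v w : V) (k : ℕ) :
    (σ.setNat v k).nat w = if w = v then k else σ.nat w := Function.update_apply ..

lemma Store.arr_setNat {V A : Type} [DecidableEq V] (σ : Store V A) (v : V) (k : ℕ) :
    (σ.setNat v k).arr = σ.arr := rfl

lemma Store.nat_setArr {V A : Type} [DecidableEq A] (σ : Store V A) (a : A) (i : ℕ) (r : ℝ) :
    (σ.setArr a i r).nat = σ.nat := rfl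

lemma Store.arr_setArr {V A : Type} [DecidableEq A] (σ : Store V A) (a b : A) (i j : ℕ) (r : ℝ) :
    (σ.setArr a i r).arr b j = if b = a then (if j = i then r else σ.arr a j) else σ.arr b j := by
  simp only [Store.setArr, Function.update_apply]
  split_ifs <;> simp_all

/-- Correctness and time go through one induction because the bound c on a round may rely on the
invariant. The extra unit is the charge for the loop step. -/
lemma runLoop_invariant {V A : Type} {step : ℕ → Store V A → Store V A × ℕ}
    {P : ℕ → Store V A → Prop} {m c : ℕ} {σ : Store V A} (h0 : P 0 σ)
    (h : ∀ k < m, ∀ τ, P k τ → P (k + 1) (step k τ).1 ∧ (step k τ).2 ≤ c) :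
    P m (runLoop step m σ).1 ∧ (runLoop step m σ).2 ≤ m * (c + 1) := by
  induction m with
  | zero => exact ⟨h0, by simp [runLoop]⟩
  | succ m ih =>
    obtain ⟨h1, h2⟩ := ih fun k hk => h k (hk.trans (Nat.lt_succ_self m))
    obtain ⟨h3, h4⟩ := h m (Nat.lt_succ_self m) _ h1
    refine ⟨h3, ?_⟩
    simp only [runLoop]
    linarith [add_one_mul m (c + 1)]

variable {V A : Type} [DecidableEq V] [DecidableEq A]

lemma fst_run_seq (c c' : Cmd V A) (σ : Store V A) :
    ((Cmd.seq c c').run σ).1 = (c'.run (c.run σ).1).1 := rfl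

lemma snd_run_seq (c c' : Cmd V A) (σ : Store V A) :
    ((Cmd.seq c c').run σ).2 = (c.run σ).2 + (c'.run (c.run σ).1).2 := rfl

/-- A loop invariant together with a bound on the time of one round. -/
lemma run_loop_invariant {v : V} {e : NExp V} {c : Cmd V A} {P : ℕ → Store V A → Prop}
    {m b : ℕ} {σ : Store V A} (hm : e.eval σ = m) (h0 : P 0 σ)
    (h : ∀ k < m, ∀ τ, P k τ →
      P (k + 1) (c.run (τ.setNat v k)).1 ∧ (c.run (τ.setNat v k)).2 ≤ b) :
    P m ((Cmd.loop v e c).run σ).1 ∧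
      ((Cmd.loop v e c).run σ).2 ≤ e.cost + 1 + m * (b + 1) := by
  subst hm
  have hl := runLoop_invariant (step := fun k τ => c.run (τ.setNat v k)) h0 h
  exact ⟨hl.1, Nat.add_le_add_left hl.2 _⟩

end Machine

/-! ### Correctness and running time of the inference program -/

/-- The arrays that hold the input of the algorithm. -/
def Arr.isInput : Arr → Bool
  | .point | .outcome | .query | .context | .priorA | .priorB | .lipschitz | .kappa => true
  | _ => false

variable {d t : ℕ} {σ τ : Memory} {κ L B α β Δ : ℝ} {S : Data d t} {x : Cube d} {n s : ℕ}

lemma HoldsInput.setArr (h : HoldsInput σ κ L B α β S x) {a : Arr} (ha : a.isInput = false)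
    (i : ℕ) (r : ℝ) : HoldsInput (σ.setArr a i r) κ L B α β S x := by
  have e : ∀ b : Arr, b.isInput = true → (σ.setArr a i r).arr b = σ.arr b := by
    intro b hb
    refine Function.update_of_ne ?_ _ _
    rintro rfl
    simp [ha] at hb
  constructor
  · exact h.tests
  · exact h.dim
  · rw [e _ rfl]; exact h.point
  · rw [e _ rfl]; exact h.outcome
  · rw [e _ rfl]; exact h.query
  · rw [e _ rfl]; exact h.context
  · rw [e _ rfl]; exact h.priorA
  · rw [e _ rfl]; exact h.priorB
  · rw [e _ rfl]; exact h.lipschitz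
  · rw [e _ rfl]; exact h.kappa

lemma HoldsInput.setNat (h : HoldsInput σ κ L B α β S x) {v : Reg} (h1 : v ≠ .tests)
    (h2 : v ≠ .dim) (k : ℕ) : HoldsInput (σ.setNat v k) κ L B α β S x := by
  constructor <;> simp only [Store.nat_setNat, Store.arr_setNat, h1.symm, h2.symm, if_false]
  exacts [h.tests, h.dim, h.point, h.outcome, h.query, h.context, h.priorA, h.priorB, h.lipschitz,
    h.kappa]

lemma run_setWidth (h : HoldsInput σ κ L B α β S x) (hL : 0 < L) (hB1 : B < 1) :
    (HoldsInput (setWidth.run σ).1 κ L B α β S x ∧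
      (setWidth.run σ).1.arr .width 0 = kernelWidth d κ L B t) ∧ (setWidth.run σ).2 ≤ 30 := by
  have e : (setWidth.run σ).1 = σ.setArr .width 0 (kernelWidth d κ L B t) := by
    simp only [setWidth, Cmd.run, RExp.eval, NExp.eval, scalar, h.kappa, h.dim, h.lipschitz,
      h.context, h.tests]
    rw [kernelWidth_eq d hL hB1]
    congr 3
    · push_cast; ring
    · push_cast; ring
  refine ⟨?_, ?_⟩
  · rw [e]
    exact ⟨h.setArr rfl _ _, by simp [Store.arr_setArr]⟩
  · simp [setWidth, Cmd.run, RExp.cost, NExp.cost, scalar]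

/-- The memory during the scan of the data. -/
structure Scanning (τ : Memory) (κ L B α β : ℝ) (S : Data d t) (x : Cube d) (Δ : ℝ)
    (n s i : ℕ) : Prop where
  input : HoldsInput τ κ L B α β S x
  width : τ.arr .width 0 = Δ
  near : τ.nat .near = n
  succs : τ.nat .succs = s
  index : τ.nat .i = i

lemma Scanning.setFlag {i : ℕ} (h : Scanning τ κ L B α β S x Δ n s i) (r : ℝ) :
    Scanning (τ.setArr .flag 0 r) κ L B α β S x Δ n s i :=
  ⟨h.input.setArr rfl _ _, by simp [Store.arr_setArr, h.width], h.near, h.succs, h.index⟩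

lemma Scanning.setJ {i : ℕ} (h : Scanning τ κ L B α β S x Δ n s i) (k : ℕ) :
    Scanning (τ.setNat .j k) κ L B α β S x Δ n s i :=
  ⟨h.input.setNat (by decide) (by decide) _, h.width, by simp [Store.nat_setNat, h.near],
    by simp [Store.nat_setNat, h.succs], by simp [Store.nat_setNat, h.index]⟩

-- After k rounds the flag tells whether the first k coordinates are within Δ: it starts at 1 and is
-- only ever cleared. The two comparisons in a round are the two halves of the absolute value
-- inequality.
open Classical in
lemma run_testNear (i : Fin t) (h : Scanning σ κ L B α β S x Δ n s i) :
    (Scanning (testNear.run σ).1 κ L B α β S x Δ n s i ∧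
      (testNear.run σ).1.arr .flag 0 = if i ∈ neighbors Δ S x then 1 else 0) ∧
    (testNear.run σ).2 ≤ 40 * d + 10 := by
  let P : ℕ → Memory → Prop := fun k τ => Scanning τ κ L B α β S x Δ n s i ∧
    τ.arr .flag 0 = if ∀ j : Fin d, (j : ℕ) < k → |x.vec j - (S i).1.vec j| ≤ Δ then 1 else 0
  have hinit : P 0 (σ.setArr .flag 0 1) := ⟨h.setFlag 1, by simp [Store.arr_setArr]⟩
  have hloop := run_loop_invariant (P := P) (v := Reg.j) (e := .var .dim) (m := d) (b := 39)
    (c := .seq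
        (.ifLE (.sub (.get .query (.var .j)) pointCoord) (scalar .width)
          .skip (.setR .flag (.lit 0) (.lit 0)))
        (.ifLE (.sub pointCoord (.get .query (.var .j))) (scalar .width)
          .skip (.setR .flag (.lit 0) (.lit 0)))) hinit.1.input.dim hinit (by
    rintro k hk τ ⟨hτ, hflag⟩
    have hτ' := hτ.setJ k
    have hq : τ.arr .query k = x.vec ⟨k, hk⟩ := hτ.input.query ⟨k, hk⟩
    have hp : τ.arr .point (i * d + k) = (S i).1.vec ⟨k, hk⟩ := hτ.input.point i ⟨k, hk⟩
    have hforall : (∀ j : Fin d, (j : ℕ) < k + 1 → |x.vec j - (S i).1.vec j| ≤ Δ) ↔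
        (∀ j : Fin d, (j : ℕ) < k → |x.vec j - (S i).1.vec j| ≤ Δ) ∧
          |x.vec ⟨k, hk⟩ - (S i).1.vec ⟨k, hk⟩| ≤ Δ := by
      constructor
      · exact fun hj => ⟨fun j hjk => hj j (hjk.trans (Nat.lt_succ_self k)),
          hj ⟨k, hk⟩ (Nat.lt_succ_self k)⟩
      · rintro ⟨h1, h2⟩ j hj
        rcases Nat.lt_succ_iff_lt_or_eq.1 hj with h3 | h3
        · exact h1 j h3
        · have : j = ⟨k, hk⟩ := Fin.ext h3
          rw [this]; exact h2
    have habs : |x.vec ⟨k, hk⟩ - (S i).1.vec ⟨k, hk⟩| ≤ Δ ↔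
        x.vec ⟨k, hk⟩ - (S i).1.vec ⟨k, hk⟩ ≤ Δ ∧ (S i).1.vec ⟨k, hk⟩ - x.vec ⟨k, hk⟩ ≤ Δ := by
      rw [abs_sub_le_iff]
    simp only [P, hforall, habs]
    by_cases h1 : x.vec ⟨k, hk⟩ - (S i).1.vec ⟨k, hk⟩ ≤ Δ <;>
    by_cases h2 : (S i).1.vec ⟨k, hk⟩ - x.vec ⟨k, hk⟩ ≤ Δ <;>
    simp [Cmd.run, RExp.eval, NExp.eval, RExp.cost, NExp.cost, scalar, pointCoord,
      Store.nat_setNat, Store.arr_setNat, Store.nat_setArr, Store.arr_setArr, hτ.index,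
      hτ.input.dim, hτ.width, hq, hp, h1, h2, hτ', Scanning.setFlag, hflag])
  have hfirst : ((Cmd.setR .flag (.lit 0) (.lit 1) : Cmd Reg Arr).run σ).1 =
      σ.setArr .flag 0 1 := by
    simp [Cmd.run, RExp.eval, NExp.eval]
  rw [testNear, fst_run_seq, snd_run_seq, hfirst]
  refine ⟨⟨hloop.1.1, ?_⟩, ?_⟩
  · refine hloop.1.2.trans ?_
    simp [neighbors]
  · have := hloop.2
    simp only [NExp.cost] at this
    refine (Nat.add_le_add_left this _).trans ?_
    simp only [Cmd.run, RExp.cost, NExp.cost]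
    omega

/-- The number of elements of `A` below `k`. -/
def countBelow {t : ℕ} (A : Finset (Fin t)) (k : ℕ) : ℕ := (A.filter fun i : Fin t => (i : ℕ) < k).card

lemma countBelow_succ {t : ℕ} (A : Finset (Fin t)) {k : ℕ} (hk : k < t) :
    countBelow A (k + 1) = countBelow A k + if (⟨k, hk⟩ : Fin t) ∈ A then 1 else 0 := by
  have hsplit : A.filter (fun i : Fin t => (i : ℕ) < k + 1) =
      A.filter (fun i : Fin t => (i : ℕ) < k) ∪ A.filter (fun i : Fin t => i = ⟨k, hk⟩) := by
    rw [← Finset.filter_or]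
    refine Finset.filter_congr fun i _ => ?_
    rw [Fin.ext_iff, Nat.lt_succ_iff_lt_or_eq]
  rw [countBelow, hsplit, Finset.card_union_of_disjoint, Finset.filter_eq', countBelow]
  · split_ifs <;> simp
  · refine Finset.disjoint_filter.2 fun i _ h1 h2 => ?_
    rw [h2] at h1
    exact lt_irrefl _ h1

lemma countBelow_zero {t : ℕ} (A : Finset (Fin t)) : countBelow A 0 = 0 := by simp [countBelow]

lemma countBelow_self {t : ℕ} (A : Finset (Fin t)) : countBelow A t = A.card := by
  simp [countBelow]

lemma run_countNear (h : HoldsInput σ κ L B α β S x) (hw : σ.arr .width 0 = Δ) :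
    (HoldsInput (countNear.run σ).1 κ L B α β S x ∧
      (countNear.run σ).1.nat .near = numNear Δ S x ∧
      (countNear.run σ).1.nat .succs = numSucc Δ S x) ∧
    (countNear.run σ).2 ≤ t * (40 * d + 40) + 10 := by
  classical
  let P : ℕ → Memory → Prop := fun k τ => HoldsInput τ κ L B α β S x ∧ τ.arr .width 0 = Δ ∧
    τ.nat .near = countBelow (neighbors Δ S x) k ∧
    τ.nat .succs = countBelow ((neighbors Δ S x).filter fun i => (S i).2 = true) k
  have hinit : P 0 ((σ.setNat .near 0).setNat .succs 0) :=
    ⟨(h.setNat (by decide) (by decide) _).setNat (by decide) (by decide) _, hw,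
      by simp [Store.nat_setNat, countBelow_zero], by simp [Store.nat_setNat, countBelow_zero]⟩
  have hloop := run_loop_invariant (P := P) (v := Reg.i) (e := .var .tests) (m := t)
    (b := 40 * d + 39)
    (c := .seq testNear <| .ifLE (.lit 1) (scalar .flag)
      (.seq (.setN .near (.add (.var .near) (.lit 1)))
        (.ifLE (.lit 1) (.get .outcome (.var .i))
          (.setN .succs (.add (.var .succs) (.lit 1)))
          .skip))
      .skip) hinit.1.tests hinit (by
    rintro k hk τ ⟨hτ, hwτ, hn, hs⟩
    have hscan : Scanning (τ.setNat .i k) κ L B α β S x Δ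
        (countBelow (neighbors Δ S x) k)
        (countBelow ((neighbors Δ S x).filter fun i => (S i).2 = true) k) (⟨k, hk⟩ : Fin t) :=
      ⟨hτ.setNat (by decide) (by decide) _, hwτ, by simp [Store.nat_setNat, hn],
        by simp [Store.nat_setNat, hs], by simp [Store.nat_setNat]⟩
    obtain ⟨⟨hρ, hflag⟩, hcost⟩ := run_testNear (⟨k, hk⟩ : Fin t) hscan
    rw [fst_run_seq, snd_run_seq]
    set ρ := (testNear.run (τ.setNat .i k)).1
    have hout : ρ.arr .outcome k = if (S ⟨k, hk⟩).2 = true then 1 else 0 :=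
      hρ.input.outcome ⟨k, hk⟩
    have hi : ρ.nat .i = k := hρ.index
    simp only [P, countBelow_succ _ hk, Finset.mem_filter]
    have h1 := hρ.input
    have h2 : HoldsInput (ρ.setNat .near (countBelow (neighbors Δ S x) k + 1)) κ L B α β S x :=
      h1.setNat (by decide) (by decide) _
    by_cases hmem : (⟨k, hk⟩ : Fin t) ∈ neighbors Δ S x <;>
    by_cases hsuc : (S ⟨k, hk⟩).2 = true <;>
    simp [Cmd.run, RExp.eval, NExp.eval, RExp.cost, NExp.cost, scalar,
      Store.nat_setNat, Store.arr_setNat, hflag, hmem, hsuc, hout, hi, hρ.near, hρ.succs, hρ.width,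
      not_le.2 (zero_lt_one' ℝ), h1, h2, HoldsInput.setNat] <;> omega)
  refine ⟨⟨hloop.1.1, ?_, ?_⟩, ?_⟩
  · exact hloop.1.2.2.1.trans (countBelow_self _)
  · exact hloop.1.2.2.2.trans (countBelow_self _)
  · have := hloop.2
    rw [countNear, snd_run_seq, snd_run_seq]
    simp only [NExp.cost] at this
    refine (Nat.add_le_add_left (Nat.add_le_add_left this _) _).trans ?_
    simp only [Cmd.run, NExp.cost]
    linarith

/-- The top weight contains no power of B, so it is positive even when B = 0; this makes it a safe
unit for the downward recursion. -/
lemma mixWeight_pos (hα : 0 < α) (hβ : 0 < β) (hsn : s ≤ n) : 0 < mixWeight α β B n s s := by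
  have h : (0 : ℝ) ≤ (n : ℝ) - s := sub_nonneg.2 (by exact_mod_cast hsn)
  rw [mixWeight, Nat.choose_self, Nat.sub_self, pow_zero, mul_one, Nat.cast_one, one_mul]
  exact mul_pos (Real.Gamma_pos_of_pos (by positivity)) (Real.Gamma_pos_of_pos (by positivity))

/-- Combines the recursion of binomial coefficients with Γ(z + 1) = zΓ(z) in both Gamma factors. The
natural-number subtractions are exact because i < s ≤ n. -/
lemma mixWeight_eq_succ (hα : 0 < α) (hβ : 0 < β) (hsn : s ≤ n) {i : ℕ} (hi : i < s) :
    mixWeight α β B n s i = mixWeight α β B n s (i + 1) *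
      (B * ((i : ℝ) + 1) * (β + ((n - 1 - i : ℕ) : ℝ))) / (((s - i : ℕ) : ℝ) * (α + i)) := by
  have hsi : 0 < s - i := by omega
  have hsi' : (0 : ℝ) < ((s - i : ℕ) : ℝ) := by exact_mod_cast hsi
  have hc : (s.choose (i + 1) : ℝ) * ((i : ℝ) + 1) = s.choose i * ((s - i : ℕ) : ℝ) := by
    exact_mod_cast Nat.choose_succ_right_eq s i
  have hG1 : Real.Gamma (α + (i + 1 : ℕ)) = (α + i) * Real.Gamma (α + i) := by
    rw [← Real.Gamma_add_one (by positivity)]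
    push_cast; ring_nf
  have hG2 : Real.Gamma (β + ((n : ℝ) - i)) =
      (β + ((n - 1 - i : ℕ) : ℝ)) * Real.Gamma (β + ((n : ℝ) - (i + 1 : ℕ))) := by
    have e : ((n - 1 - i : ℕ) : ℝ) = (n : ℝ) - (i + 1 : ℕ) := by
      rw [← Nat.cast_sub (by omega)]
      congr 1
      omega
    rw [← e, ← Real.Gamma_add_one (by positivity), e]
    push_cast; ring_nf
  have hB : B ^ (s - i) = B ^ (s - (i + 1)) * B := by
    rw [← pow_succ]; congr 1; omega
  have hα' : 0 < α + i := by positivity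
  rw [eq_div_iff (by positivity), mixWeight, mixWeight, hG1, hG2, hB]
  linear_combination (-(Real.Gamma (α + i) * (α + i) * (β + ((n - 1 - i : ℕ) : ℝ)) *
    Real.Gamma (β + ((n : ℝ) - (i + 1 : ℕ))) * (B ^ (s - (i + 1)) * B))) * hc

lemma run_setWeights (h : HoldsInput σ κ L B α β S x) (hα : 0 < α) (hβ : 0 < β) (hsn : s ≤ n)
    (hn : σ.nat .near = n) (hs : σ.nat .succs = s) :
    (HoldsInput (setWeights.run σ).1 κ L B α β S x ∧ (setWeights.run σ).1.nat .near = n ∧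
      (setWeights.run σ).1.nat .succs = s ∧
      ∀ i ≤ s, (setWeights.run σ).1.arr .weight i =
        mixWeight α β B n s i / mixWeight α β B n s s) ∧
    (setWeights.run σ).2 ≤ s * 60 + 10 := by
  have hpos := mixWeight_pos (B := B) hα hβ hsn
  -- After k rounds the cells s − k, …, s hold the weights in units of the top one; the cells below
  -- are still arbitrary.
  let P : ℕ → Memory → Prop := fun k τ => HoldsInput τ κ L B α β S x ∧ τ.nat .near = n ∧
    τ.nat .succs = s ∧ ∀ i ≤ s, s ≤ i + k →
      τ.arr .weight i = mixWeight α β B n s i / mixWeight α β B n s s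
  have hinit : P 0 (σ.setArr .weight s 1) := by
    refine ⟨h.setArr rfl _ _, hn, hs, fun i h1 h2 => ?_⟩
    obtain rfl : i = s := by omega
    simp [Store.arr_setArr, div_self hpos.ne']
  have hloop := run_loop_invariant (P := P) (v := Reg.j) (e := .var .succs) (m := s)
    (b := 59)
    (c := .seq (.setN .i (.sub (.sub (.var .succs) (.lit 1)) (.var .j))) <|
      .setR .weight (.var .i)
        (.div
          (.mul (.get .weight (.add (.var .i) (.lit 1)))
            (.mul (.mul (scalar .context) (.ofNat (.add (.var .i) (.lit 1))))
              (.add (scalar .priorB) (.ofNat (.sub (.sub (.var .near) (.lit 1)) (.var .i))))))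
          (.mul (.ofNat (.sub (.var .succs) (.var .i)))
            (.add (scalar .priorA) (.ofNat (.var .i)))))) hinit.2.2.1 hinit (by
    rintro k hk τ ⟨hτ, hnτ, hsτ, hwτ⟩
    have hi : s - 1 - k < s := by omega
    have hrun : ((Cmd.seq (.setN .i (.sub (.sub (.var .succs) (.lit 1)) (.var .j))) <|
      .setR .weight (.var .i)
        (.div
          (.mul (.get .weight (.add (.var .i) (.lit 1)))
            (.mul (.mul (scalar .context) (.ofNat (.add (.var .i) (.lit 1))))
              (.add (scalar .priorB) (.ofNat (.sub (.sub (.var .near) (.lit 1)) (.var .i))))))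
          (.mul (.ofNat (.sub (.var .succs) (.var .i)))
            (.add (scalar .priorA) (.ofNat (.var .i)))))).run (τ.setNat .j k)).1 =
        ((τ.setNat .j k).setNat .i (s - 1 - k)).setArr .weight (s - 1 - k)
          (mixWeight α β B n s (s - 1 - k) / mixWeight α β B n s s) := by
      rw [mixWeight_eq_succ hα hβ hsn hi]
      simp [Cmd.run, RExp.eval, NExp.eval, scalar, Store.nat_setNat, Store.arr_setNat, hnτ, hsτ,
        hτ.context, hτ.priorA, hτ.priorB,
        hwτ (s - 1 - k + 1) (by omega) (by omega)]
      congr 1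
      ring
    refine ⟨?_, ?_⟩
    · rw [hrun]
      refine ⟨((hτ.setNat (by decide) (by decide) _).setNat (by decide) (by decide) _).setArr rfl
        _ _, by simp [Store.nat_setArr, Store.nat_setNat, hnτ],
        by simp [Store.nat_setArr, Store.nat_setNat, hsτ], fun i h1 h2 => ?_⟩
      by_cases hik : i = s - 1 - k
      · simp [Store.arr_setArr, hik]
      · simp only [Store.arr_setArr, Store.arr_setNat, if_true, hik, if_false]
        exact hwτ i h1 (by omega)
    · simp [Cmd.run, RExp.cost, NExp.cost, scalar])
  have hfirst : ((Cmd.setR .weight (.var .succs) (.lit 1) : Cmd Reg Arr).run σ).1 =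
      σ.setArr .weight s 1 := by
    simp [Cmd.run, RExp.eval, NExp.eval, hs]
  rw [setWeights, fst_run_seq, snd_run_seq, hfirst]
  refine ⟨⟨hloop.1.1, hloop.1.2.1, hloop.1.2.2.1, fun i hi => hloop.1.2.2.2 i hi (by omega)⟩, ?_⟩
  have := hloop.2
  simp only [NExp.cost] at this
  refine (Nat.add_le_add_left this _).trans ?_
  simp only [Cmd.run, RExp.cost, NExp.cost]
  omega

lemma run_writePosterior (h : HoldsInput σ κ L B α β S x) (hα : 0 < α) (hβ : 0 < β)
    (hsn : s ≤ n) (hn : σ.nat .near = n) (hs : σ.nat .succs = s)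
    (hw : ∀ i ≤ s, σ.arr .weight i = mixWeight α β B n s i / mixWeight α β B n s s) :
    HoldsMixture (writePosterior.run σ).1 α β B n s ∧
    (writePosterior.run σ).2 ≤ (s + 1) * 60 + 10 := by
  have hpos := mixWeight_pos (B := B) hα hβ hsn
  let P : ℕ → Memory → Prop := fun k τ => HoldsInput τ κ L B α β S x ∧ τ.nat .near = n ∧
    τ.nat .succs = s ∧
    (∀ i ≤ s, τ.arr .weight i = mixWeight α β B n s i / mixWeight α β B n s s) ∧
    τ.arr .total 0 = (∑ j ∈ Finset.range k, mixWeight α β B n s j) / mixWeight α β B n s s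
  have hinit : P 0 (σ.setArr .total 0 0) :=
    ⟨h.setArr rfl _ _, hn, hs, fun i hi => by simp [Store.arr_setArr, hw i hi],
      by simp [Store.arr_setArr]⟩
  have hsum := run_loop_invariant (P := P) (v := Reg.i) (e := .add (.var .succs) (.lit 1))
    (m := s + 1) (b := 19)
    (c := .setR .total (.lit 0) (.add (scalar .total) (.get .weight (.var .i))))
    (by simp only [NExp.eval, hinit.2.2.1]) hinit (by
    rintro k hk τ ⟨hτ, hnτ, hsτ, hwτ, htot⟩
    have hrun : ((Cmd.setR .total (.lit 0) (.add (scalar .total)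
        (.get .weight (.var .i)))).run (τ.setNat .i k)).1 = (τ.setNat .i k).setArr .total 0
        ((∑ j ∈ Finset.range (k + 1), mixWeight α β B n s j) / mixWeight α β B n s s) := by
      simp [Cmd.run, RExp.eval, NExp.eval, scalar, Store.nat_setNat, Store.arr_setNat, htot,
        hwτ k (Nat.lt_succ_iff.1 hk), Finset.sum_range_succ, add_div]
    refine ⟨?_, ?_⟩
    · rw [hrun]
      exact ⟨(hτ.setNat (by decide) (by decide) _).setArr rfl _ _,
        by simp [Store.nat_setArr, Store.nat_setNat, hnτ],
        by simp [Store.nat_setArr, Store.nat_setNat, hsτ],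
        fun i hi => by simp [Store.arr_setArr, Store.arr_setNat, hwτ i hi],
        by simp [Store.arr_setArr]⟩
    · simp [Cmd.run, RExp.cost, NExp.cost, scalar])
  set ρ := ((Cmd.loop Reg.i (.add (.var .succs) (.lit 1))
    (.setR .total (.lit 0) (.add (scalar .total) (.get .weight (.var .i))))).run
      (σ.setArr .total 0 0)).1 with hρ
  obtain ⟨⟨hρin, hρn, hρs, hρw, hρtot⟩, hcost1⟩ := hsum
  -- The output loop writes to arrays other than `weight` and `total`, so the quantities it reads
  -- stay available in every round.
  let Q : ℕ → Memory → Prop := fun k τ => HoldsInput τ κ L B α β S x ∧ τ.nat .near = n ∧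
    τ.nat .succs = s ∧
    (∀ i ≤ s, τ.arr .weight i = mixWeight α β B n s i / mixWeight α β B n s s) ∧
    τ.arr .total 0 =
      (∑ j ∈ Finset.range (s + 1), mixWeight α β B n s j) / mixWeight α β B n s s ∧
    ∀ i < k, τ.arr .coef i = mixCoef α β B n s i ∧ τ.arr .shapeA i = α + i ∧
      τ.arr .shapeB i = β + ((n - i : ℕ) : ℝ)
  have hQ : Q 0 ρ := ⟨hρin, hρn, hρs, hρw, hρtot, fun i hi => absurd hi (Nat.not_lt_zero i)⟩
  have hout := run_loop_invariant (P := Q) (v := Reg.i) (e := .add (.var .succs) (.lit 1))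
    (m := s + 1) (b := 38)
    (c := .seq (.setR .coef (.var .i) (.div (.get .weight (.var .i)) (scalar .total))) <|
      .seq (.setR .shapeA (.var .i) (.add (scalar .priorA) (.ofNat (.var .i)))) <|
      .setR .shapeB (.var .i)
        (.add (scalar .priorB) (.ofNat (.sub (.var .near) (.var .i)))))
    (by simp only [NExp.eval, hρs]) hQ (by
    rintro k hk τ ⟨hτ, hnτ, hsτ, hwτ, htot, hdone⟩
    -- The unknown common factor, the top weight, cancels between a stored weight and the stored
    -- total.
    have hcoef : mixWeight α β B n s k / mixWeight α β B n s s /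
        ((∑ j ∈ Finset.range (s + 1), mixWeight α β B n s j) / mixWeight α β B n s s) =
        mixCoef α β B n s k := div_div_div_cancel_right₀ hpos.ne' _ _
    have hrun : ((Cmd.seq (.setR .coef (.var .i) (.div (.get .weight (.var .i))
        (scalar .total))) <|
      .seq (.setR .shapeA (.var .i) (.add (scalar .priorA) (.ofNat (.var .i)))) <|
      .setR .shapeB (.var .i)
        (.add (scalar .priorB) (.ofNat (.sub (.var .near) (.var .i))))).run (τ.setNat .i k)).1 =
        (((τ.setNat .i k).setArr .coef k (mixCoef α β B n s k)).setArr .shapeA k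
          (α + k)).setArr .shapeB k (β + ((n - k : ℕ) : ℝ)) := by
      simp [Cmd.run, RExp.eval, NExp.eval, scalar, Store.nat_setNat, Store.arr_setNat,
        Store.nat_setArr, Store.arr_setArr, hnτ, htot, hτ.priorA, hτ.priorB,
        hwτ k (Nat.lt_succ_iff.1 hk), hcoef]
    refine ⟨?_, ?_⟩
    · rw [hrun]
      refine ⟨(((hτ.setNat (by decide) (by decide) _).setArr rfl _ _).setArr rfl _ _).setArr rfl
        _ _, by simp [Store.nat_setArr, Store.nat_setNat, hnτ],
        by simp [Store.nat_setArr, Store.nat_setNat, hsτ],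
        fun i hi => by simp [Store.arr_setArr, Store.arr_setNat, hwτ i hi],
        by simp [Store.arr_setArr, Store.arr_setNat, htot], fun i hi => ?_⟩
      by_cases hik : i = k
      · simp [Store.arr_setArr, hik]
      · have := hdone i (by omega)
        simpa [Store.arr_setArr, Store.arr_setNat, hik] using this
    · simp [Cmd.run, RExp.cost, NExp.cost, scalar])
  obtain ⟨⟨_, _, hs', _, _, hall⟩, hcost2⟩ := hout
  have hfirst : ((Cmd.setR .total (.lit 0) (.lit 0) : Cmd Reg Arr).run σ).1 =
      σ.setArr .total 0 0 := by
    simp [Cmd.run, RExp.eval, NExp.eval]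
  rw [writePosterior, fst_run_seq, snd_run_seq, fst_run_seq, snd_run_seq, hfirst, ← hρ]
  refine ⟨⟨hs', fun i hi => (hall i (Nat.lt_succ_iff.2 hi)).1,
    fun i hi => (hall i (Nat.lt_succ_iff.2 hi)).2.1, fun i hi => ?_⟩, ?_⟩
  · rw [(hall i (Nat.lt_succ_iff.2 hi)).2.2, Nat.cast_sub (hi.trans hsn)]
  · refine (Nat.add_le_add_left (Nat.add_le_add hcost1 hcost2) _).trans ?_
    simp only [Cmd.run, RExp.cost, NExp.cost]
    omega

/-- The program computes the posterior, in time linear in the number of tests. -/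
theorem run_inference (h : HoldsInput σ κ L B α β S x) (hL : 0 < L) (hB1 : B < 1)
    (hα : 0 < α) (hβ : 0 < β) (ht : 0 < t) :
    HoldsMixture (inference.run σ).1 α β B (numNear (kernelWidth d κ L B t) S x)
        (numSucc (kernelWidth d κ L B t) S x) ∧
      (inference.run σ).2 ≤ (40 * d + 300) * t := by
  obtain ⟨⟨h1, hw⟩, c1⟩ := run_setWidth h hL hB1
  obtain ⟨⟨h2, hn, hs⟩, c2⟩ := run_countNear h1 hw
  have hsn := numSucc_le_numNear (kernelWidth d κ L B t) S x
  obtain ⟨⟨h3, hn3, hs3, hw3⟩, c3⟩ := run_setWeights h2 hα hβ hsn hn hs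
  obtain ⟨h4, c4⟩ := run_writePosterior h3 hα hβ hsn hn3 hs3 hw3
  refine ⟨h4, ?_⟩
  -- Since s ≤ n ≤ t, all the loops are linear in t; the additive constants are absorbed by t ≥ 1.
  have hnt : numNear (kernelWidth d κ L B t) S x ≤ t := by
    simpa [numNear] using Finset.card_le_univ (neighbors (kernelWidth d κ L B t) S x)
  rw [inference, snd_run_seq, snd_run_seq, snd_run_seq]
  nlinarith

end SmoothBeta

theorem theorem3 (d : ℕ) (N : Seminorm ℝ (Fin d → ℝ)) :
    (∀ κ : ℝ, 0 < κ → ∃ C : ℝ, 0 < C ∧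
      ∀ L B : ℝ, 0 < L → 0 ≤ B → B < 1 →
      ∀ π : SmoothBeta.Cube d → ℝ, (∀ x, 0 < π x ∧ π x ≤ 1) →
      (∀ x y, |π x - π y| ≤ L * N (x.vec - y.vec)) →
      ∀ t : ℕ, 1 ≤ L ^ 2 * ((1 - B) * t) →
        SmoothBeta.supMeanSquareError π B (SmoothBeta.kernelWidth d κ L B t) t
          ≤ ENNReal.ofReal (C * (L ^ (2 * (d : ℝ) / ((d : ℝ) + 2)) *
              ((1 - B) * t) ^ (-(2 : ℝ) / ((d : ℝ) + 2))))) ∧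
    (∃ K : ℕ, ∀ κ L B α β : ℝ, 0 < κ → 0 < L → 0 ≤ B → B < 1 → 0 < α → 0 < β →
      ∀ t : ℕ, 0 < t → ∀ (S : SmoothBeta.Data d t) (x : SmoothBeta.Cube d) (σ : SmoothBeta.Memory),
        SmoothBeta.HoldsInput σ κ L B α β S x →
        SmoothBeta.HoldsMixture (SmoothBeta.inference.run σ).1 α β B
            (SmoothBeta.numNear (SmoothBeta.kernelWidth d κ L B t) S x)
            (SmoothBeta.numSucc (SmoothBeta.kernelWidth d κ L B t) S x) ∧
          (SmoothBeta.inference.run σ).2 ≤ K * t) := by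
  exact ⟨fun κ hκ => SmoothBeta.supMeanSquareError_kernelWidth_le d N hκ,
    40 * d + 300, fun κ L B α β _ hL _ hB1 hα hβ t ht S x σ h =>
      SmoothBeta.run_inference h hL hB1 hα hβ ht⟩
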